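/- Let $p\le 4$ and $k>0$. Let $M(p)=SO(p)\times \mathrm{Diag}^+(p)$, where $\mathrm{Diag}^+(p)$ is the set of $p\times p$ diagonal matrices with positive diagonal entries, with the Riemannian metric $g_M=k\,g_{SO}\oplus g_{\mathcal D^+}$, where $g_{SO}$ is the bi-invariant metric on $SO(p)$ given at the identity by $g_{SO}(A_1,A_2)=-\tfrac12\mathrm{tr}(A_1A_2)$ and $g_{\mathcal D^+}|_D(L_1,L_2)=\mathrm{tr}(D^{-1}L_1D^{-1}L_2)$. Let $d_M$ be the geodesic distance and $\ell$ the length of piecewise smooth curves in $M(p)$. Let $F:M(p)\to \mathrm{Sym}^+(p)$, $F(U,D)=UDU^T$, where $\mathrm{Sym}^+(p)$ is the set of symmetric positive-definite $p\times p$ matrices, let $\mathcal E_X=F^{-1}(X)$, and put $d_{\mathcal{SR}}(X,Y)=\inf\{d_M(a,b): a\in\mathcal E_X,\ b\in\mathcal E_Y\}$. An $F$-minimal geodesic from $\mathcal E_X$ to $\mathcal E_Y$ is a piecewise smooth curve $\gamma:[0,1]\to M(p)$ of constant speed with $\gamma(0)\in\mathcal E_X$, $\gamma(1)\in\mathcal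 E_Y$ and $\ell(\gamma)=d_{\mathcal{SR}}(X,Y)$. A pair $(a,b)\in M(p)\times M(p)$ is a minimal pair if $a=\gamma(0)$ and $b=\gamma(1)$ for some $F$-minimal geodesic $\gamma$ from $\mathcal E_{F(a)}$ to $\mathcal E_{F(b)}$. Let $\mathcal M(X,Y)$ be the set of minimal smooth scaling-rotation (MSSR) curves from $X$ to $Y$, i.e. of the curves $F\circ\gamma$ with $\gamma$ an $F$-minimal geodesic from $\mathcal E_X$ to $\mathcal E_Y$. A pair $((U,D),(V,\Lambda))\in M(p)\times M(p)$ is geodesically antipodal if one of $U,V$ lies in the cut locus of the other in $(SO(p),g_{SO})$, and geodesically non-antipodal otherwise. For $X,Y\in\mathrm{Sym}^+(p)$, Type I (respectively Type II) non-uniqueness means that there are $F$-minimal geodesics $\gamma_1,\gamma_2$ from $\mathcal E_X$ to $\mathcal E_Y$ with $F\circ\gamma_1\ne F\circ\gamma_2$ whose endpoint pairs $(\gamma_i(0),\gamma_i(1))$ are distinct (respectively equal). Then every minimal pair in $M(p)\times M(p)$ is geodesically non-antipodal. Moreover, for all $X,Y\in\mathrm{Sym}^+(p)$ with $|\mathcal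 M(X,Y)|>1$, the non-uniqueness is purely of Type I: Type I non-uniqueness occurs and Type II non-uniqueness does not. -/

import Mathlib

open scoped Matrix Matrix.Norms.Frobenius ContDiff

noncomputable section

namespace ScalingRotation

/-! ### Riemannian submanifolds of a normed space

A submanifold is given by its set `S` of points in a normed space `E`; a Riemannian metric on it is
given by a function `g`, where `g x u v` is the inner product at the point `x ∈ S` of the tangent
vectors `u` and `v`. -/

section Riemannian

variable {E : Type*} [NormedAddCommGroup E] [NormedSpace ℝ E]

/-- `c` is continuous on `[a, b]` and, for a finite set `B` of break points, it is smooth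
(one-sidedly at the ends) on every closed subinterval without break points in its interior. -/
def PiecewiseSmoothOn (c : ℝ → E) (a b : ℝ) : Prop :=
  ContinuousOn c (Set.Icc a b) ∧
    ∃ B : Finset ℝ, ∀ x y : ℝ, a ≤ x → x < y → y ≤ b → (∀ z ∈ B, z ∉ Set.Ioo x y) →
      ContDiffOn ℝ ∞ c (Set.Icc x y)

/-- `c` restricts to a piecewise smooth curve `[a, b] → S`. -/
def IsCurveIn (S : Set E) (c : ℝ → E) (a b : ℝ) : Prop :=
  PiecewiseSmoothOn c a b ∧ ∀ t ∈ Set.Icc a b, c t ∈ S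

/-- The Riemannian length of `c` restricted to `[a, b]`. -/
def curveLength (g : E → E → E → ℝ) (c : ℝ → E) (a b : ℝ) : ℝ :=
  ∫ t in a..b, √(g (c t) (deriv c t) (deriv c t))

/-- The geodesic distance in `S`: the infimum of the lengths of the piecewise smooth curves in `S`
from `x` to `y`. -/
def riemannianDist (S : Set E) (g : E → E → E → ℝ) (x y : E) : ℝ :=
  sInf {l : ℝ | ∃ c : ℝ → E, IsCurveIn S c 0 1 ∧ c 0 = x ∧ c 1 = y ∧ l = curveLength g c 0 1}

/-- `c` has constant speed on `[a, b]`: it is parametrized proportionally to arc length. -/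
def HasConstantSpeed (g : E → E → E → ℝ) (c : ℝ → E) (a b : ℝ) : Prop :=
  ∃ v : ℝ, ∀ s t : ℝ, a ≤ s → s ≤ t → t ≤ b → curveLength g c s t = v * (t - s)

/-- `c` restricts to a minimal geodesic on `[a, b]`: a curve of constant speed that is shortest among
all piecewise smooth curves in `S` with the same endpoints. -/
def IsMinimalGeodesic (S : Set E) (g : E → E → E → ℝ) (c : ℝ → E) (a b : ℝ) : Prop :=
  IsCurveIn S c a b ∧ HasConstantSpeed g c a b ∧
    curveLength g c a b = riemannianDist S g (c a) (c b)

/-- The cut locus of `x` in `S` (for a complete `S`): the points `y` for which some minimal geodesic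
from `x` to `y` does not extend beyond `y` to a longer minimal geodesic. -/
def cutLocus (S : Set E) (g : E → E → E → ℝ) (x : E) : Set E :=
  {y | ∃ c : ℝ → E, IsMinimalGeodesic S g c 0 1 ∧ c 0 = x ∧ c 1 = y ∧
    ¬ ∃ s : ℝ, 1 < s ∧ ∃ c' : ℝ → E, IsMinimalGeodesic S g c' 0 s ∧
      Set.EqOn c c' (Set.Icc 0 1)}

end Riemannian

/-! ### The manifolds `SO(p)`, `Diag⁺(p)`, `M(p)` and `Sym⁺(p)` -/

/-- Real `p × p` matrices. -/
abbrev Mat (p : ℕ) : Type := Matrix (Fin p) (Fin p) ℝ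

/-- The rotation group `SO(p)`, as a set of matrices. -/
def SO (p : ℕ) : Set (Mat p) := (Matrix.specialOrthogonalGroup (Fin p) ℝ : Set (Mat p))

/-- Diagonal matrices with positive diagonal entries. -/
def DiagPos (p : ℕ) : Set (Mat p) := {D | D.IsDiag ∧ ∀ i, 0 < D i i}

/-- Symmetric positive-definite matrices. -/
def SymPos (p : ℕ) : Set (Mat p) := {X | X.PosDef}

/-- The space `M(p) = SO(p) × Diag⁺(p)` of eigen-decompositions. -/
def M (p : ℕ) : Set (Mat p × Mat p) := SO p ×ˢ DiagPos p

/-- The bi-invariant metric on `SO(p)` that is `-(1/2) tr (A₁ A₂)` at the identity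
(recall `U⁻¹ = Uᵀ`). -/
def soMetric {p : ℕ} (U A₁ A₂ : Mat p) : ℝ := -(1 / 2) * ((Uᵀ * A₁) * (Uᵀ * A₂)).trace

/-- The invariant metric on `Diag⁺(p)`. -/
def diagMetric {p : ℕ} (D L₁ L₂ : Mat p) : ℝ := (D⁻¹ * L₁ * (D⁻¹ * L₂)).trace

/-- The product metric on `M(p)` with weight `k` on the rotation factor. -/
def metricM {p : ℕ} (k : ℝ) (a u v : Mat p × Mat p) : ℝ :=
  k * soMetric a.1 u.1 v.1 + diagMetric a.2 u.2 v.2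

/-- The map `F(U, D) = U D Uᵀ`. -/
def F {p : ℕ} (a : Mat p × Mat p) : Mat p := a.1 * a.2 * a.1ᵀ

/-- The fiber of `F : M(p) → Sym⁺(p)` over `X`. -/
def fiber {p : ℕ} (X : Mat p) : Set (Mat p × Mat p) := {a | a ∈ M p ∧ F a = X}

/-! ### Scaling-rotation distance, minimal pairs, MSSR curves -/

/-- The scaling-rotation distance from `X` to `Y`. -/
def dSR {p : ℕ} (k : ℝ) (X Y : Mat p) : ℝ :=
  sInf {d : ℝ | ∃ a ∈ fiber X, ∃ b ∈ fiber Y, d = riemannianDist (M p) (metricM k) a b}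

/-- `γ` restricts on `[0, 1]` to an `F`-minimal geodesic from the fiber over `X` to the fiber
over `Y`. -/
def IsFMinimalGeodesic {p : ℕ} (k : ℝ) (X Y : Mat p) (γ : ℝ → Mat p × Mat p) : Prop :=
  IsCurveIn (M p) γ 0 1 ∧ HasConstantSpeed (metricM k) γ 0 1 ∧
    γ 0 ∈ fiber X ∧ γ 1 ∈ fiber Y ∧ curveLength (metricM k) γ 0 1 = dSR k X Y

/-- The points `a`, `b` of `M(p)` form a minimal pair. -/
def IsMinimalPair {p : ℕ} (k : ℝ) (a b : Mat p × Mat p) : Prop :=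
  ∃ γ : ℝ → Mat p × Mat p, IsFMinimalGeodesic k (F a) (F b) γ ∧ γ 0 = a ∧ γ 1 = b

/-- The set of minimal smooth scaling-rotation curves `[0, 1] → Sym⁺(p)` from `X` to `Y`. -/
def MSSR {p : ℕ} (k : ℝ) (X Y : Mat p) : Set (Set.Icc (0 : ℝ) 1 → Mat p) :=
  {χ | ∃ γ : ℝ → Mat p × Mat p, IsFMinimalGeodesic k X Y γ ∧ ∀ t, χ t = F (γ t)}

/-- `(U, V)` is geodesically antipodal in `SO(p)`: one point is in the cut locus of the other. -/
def SOAntipodal {p : ℕ} (U V : Mat p) : Prop :=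
  V ∈ cutLocus (SO p) soMetric U ∨ U ∈ cutLocus (SO p) soMetric V

/-- A pair in `M(p)` is geodesically antipodal if its `SO(p)`-components are. -/
def GeodesicallyAntipodal {p : ℕ} (a b : Mat p × Mat p) : Prop := SOAntipodal a.1 b.1

/-- Type I non-uniqueness: two `F`-minimal geodesics with different projections and distinct
pairs of endpoints. -/
def TypeINonuniqueness {p : ℕ} (k : ℝ) (X Y : Mat p) : Prop :=
  ∃ γ₁ γ₂ : ℝ → Mat p × Mat p, IsFMinimalGeodesic k X Y γ₁ ∧ IsFMinimalGeodesic k X Y γ₂ ∧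
    (∃ t ∈ Set.Icc (0 : ℝ) 1, F (γ₁ t) ≠ F (γ₂ t)) ∧ (γ₁ 0, γ₁ 1) ≠ (γ₂ 0, γ₂ 1)

/-- Type II non-uniqueness: two `F`-minimal geodesics with different projections and the same
pair of endpoints. -/
def TypeIINonuniqueness {p : ℕ} (k : ℝ) (X Y : Mat p) : Prop :=
  ∃ γ₁ γ₂ : ℝ → Mat p × Mat p, IsFMinimalGeodesic k X Y γ₁ ∧ IsFMinimalGeodesic k X Y γ₂ ∧
    (∃ t ∈ Set.Icc (0 : ℝ) 1, F (γ₁ t) ≠ F (γ₂ t)) ∧ (γ₁ 0, γ₁ 1) = (γ₂ 0, γ₂ 1)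

end ScalingRotation

end

/-!
Columns of a rotation matrix move on spheres, and this makes `SO(p)` comparable with a product of
spheres. For an orthogonal matrix `Q`, the map that sends `(U, D)` to the columns of `U * Q` and to
the logarithms of the diagonal entries of `D` preserves the lengths of curves, when the spheres are
weighted by `k / 2`. So the distance in the product of spheres and lines, the norm of the vector
`gap k Q a b`, bounds lengths in `M(p)` from below (`norm_gap_le_curveLength`).

The bound is sharp for a suitable `Q`. Choose `Q` so that its columns are eigenvectors of the
symmetric part of `Uᵀ * V` (`exists_isAdapted`). If no column of `U * Q` is antipodal to that of
`V * Q`, then there is an explicit geodesic from `U` to `V` in which each column moves along an arc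
of a great circle (`connectingCurve`), and its length is the norm of `gap`. Since arcs of great
circles shorter than `π` are the unique shortest curves on a sphere, and since the Euclidean norm is
strictly convex, every shortest curve of constant speed agrees with this geodesic
(`eqOn_of_curveLength_le`). It stays minimal until some rotation angle reaches `π`, so `V` is not in
the cut locus of `U` (`IsNonantipodalBasis.notMem_cutLocus`).

It remains to see that the endpoints of an `F`-minimal geodesic have no rotation angle `π`
(`IsMinimalPair.isNonantipodalBasis`). The eigenvalue `-1` of a rotation `R = Uᵀ * V` is at least
double, so that such an angle makes the rotational part of the squared length at least `k * π ^ 2`.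
The point `(V * ε, Λ)` lies in the same fiber as `(V, Λ)` for each diagonal matrix `ε` of signs with
determinant one. By Jordan's inequality `θ ^ 2 ≤ π ^ 2 / 2 * (1 - cos θ)`, the rotational part of the
squared distance to that point is less than `k * π ^ 2` as soon as the trace of `R * ε` exceeds
`p - 4`, or equals `p - 4` while `R * ε` is not symmetric (`sum_angle_sq_lt`). For `2 ≤ p ≤ 4`
these traces average to zero, which is at least `p - 4`, so some `ε` will do unless `p = 4` and every
`R * ε` is symmetric with trace zero; but then `R` would have a zero column (`exists_sign_change`).
In dimension `p ≤ 1` there is no rotation angle `π`.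

Hence minimal pairs are geodesically non-antipodal, and an `F`-minimal geodesic is determined by its
endpoints. This excludes non-uniqueness of Type II, and any two distinct minimal scaling-rotation
curves then give non-uniqueness of Type I.
-/

namespace ScalingRotation

open Filter Topology InnerProductGeometry MeasureTheory

/-! ### Curves on a sphere -/

section Sphere

variable {E : Type*} [NormedAddCommGroup E]

/-- The distance of a moving point from its starting position has the norm of the velocity as its
right derivative. -/
theorem hasDerivWithinAt_norm_sub [NormedSpace ℝ E] {f : ℝ → E} {f' : E} {t : ℝ}
    (h : HasDerivWithinAt f f' (Set.Ioi t) t) :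
    HasDerivWithinAt (fun z => ‖f z - f t‖) ‖f'‖ (Set.Ioi t) t := by
  rw [hasDerivWithinAt_iff_tendsto_slope' (by simp)] at h ⊢
  refine h.norm.congr' ?_
  filter_upwards [self_mem_nhdsWithin] with z hz
  have hz' : 0 < z - t := sub_pos.2 hz
  simp [slope_def_module, norm_smul, abs_of_pos hz']

variable [InnerProductSpace ℝ E]

theorem angle_eq_two_mul_arcsin {x y : E} (hx : ‖x‖ = 1) (hy : ‖y‖ = 1) :
    angle x y = 2 * Real.arcsin (‖y - x‖ / 2) := by
  have h1 : ‖y - x‖ ^ 2 = 2 - 2 * Real.cos (angle x y) := by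
    rw [@norm_sub_sq_real, hx, hy, cos_angle, hx, hy, real_inner_comm]; ring
  have h0 := angle_nonneg x y
  have hpi := angle_le_pi x y
  have h2 : Real.cos (angle x y) = 1 - 2 * Real.sin (angle x y / 2) ^ 2 := by
    have := Real.cos_two_mul (angle x y / 2)
    rw [mul_div_cancel₀ _ (two_ne_zero)] at this
    rw [this, Real.cos_sq']; ring
  have h3 : 0 ≤ Real.sin (angle x y / 2) :=
    Real.sin_nonneg_of_nonneg_of_le_pi (by linarith) (by linarith)
  have h4 : ‖y - x‖ / 2 = Real.sin (angle x y / 2) := by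
    have : ‖y - x‖ ^ 2 = (2 * Real.sin (angle x y / 2)) ^ 2 := by rw [h1, h2]; ring
    rw [sq_eq_sq₀ (norm_nonneg _) (by positivity)] at this
    linarith
  rw [h4, Real.arcsin_sin (by linarith) (by linarith)]
  ring

/-- For a curve on the unit sphere, the angle to the starting position grows at the initial rate
given by the norm of the velocity. -/
theorem hasDerivWithinAt_angle {v : ℝ → E} {v' : E} {t : ℝ}
    (h : HasDerivWithinAt v v' (Set.Ioi t) t) (h1 : ‖v t‖ = 1)
    (hv : ∀ᶠ z in 𝓝[>] t, ‖v z‖ = 1) :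
    HasDerivWithinAt (fun z => angle (v t) (v z)) ‖v'‖ (Set.Ioi t) t := by
  have hn := hasDerivWithinAt_norm_sub h
  have hn2 : HasDerivWithinAt (fun z => ‖v z - v t‖ / 2) (‖v'‖ / 2) (Set.Ioi t) t :=
    hn.div_const 2
  have ha : HasDerivAt Real.arcsin (1 / √(1 - (‖v t - v t‖ / 2) ^ 2)) (‖v t - v t‖ / 2) :=
    Real.hasDerivAt_arcsin (by simp) (by simp)
  have hc := (ha.comp_hasDerivWithinAt t hn2).const_mul 2
  have he : 2 * (1 / √(1 - (‖v t - v t‖ / 2) ^ 2) * (‖v'‖ / 2)) = ‖v'‖ := by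
    simp; ring
  rw [he] at hc
  refine hc.congr_of_eventuallyEq ?_ ?_
  · filter_upwards [hv] with z hz
    exact angle_eq_two_mul_arcsin h1 hz
  · exact angle_eq_two_mul_arcsin h1 h1

/-- A point that divides the angle `γ < π` between two unit vectors in the ratio `s : (1 - s)`
lies on the great circle arc that joins them. -/
theorem eq_of_angle_eq_mul {u v w : E} {γ s : ℝ} (hu : ‖u‖ = 1) (hv : ‖v‖ = 1) (hw : ‖w‖ = 1)
    (hγ : angle u w = γ) (hpi : γ < Real.pi) (h1 : angle u v = s * γ)
    (h2 : angle v w = (1 - s) * γ) :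
    v = (Real.sin γ)⁻¹ • (Real.sin ((1 - s) * γ) • u + Real.sin (s * γ) • w) ∨
      γ = 0 ∧ v = u := by
  have h0 : 0 ≤ γ := hγ ▸ angle_nonneg u w
  rcases h0.eq_or_lt with h0 | h0
  · right
    refine ⟨h0.symm, ?_⟩
    rw [← h0, mul_zero, angle_eq_zero_iff] at h1
    obtain ⟨-, r, hr, rfl⟩ := h1
    rw [norm_smul, hu, mul_one, Real.norm_of_nonneg hr.le] at hv
    simp [hv]
  · left
    have hs : 0 < Real.sin γ := Real.sin_pos_of_pos_of_lt_pi h0 hpi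
    have huv : inner ℝ u v = Real.cos (s * γ) := by rw [← h1, cos_angle, hu, hv]; simp
    have hvw : inner ℝ v w = Real.cos ((1 - s) * γ) := by rw [← h2, cos_angle, hw, hv]; simp
    have huw : inner ℝ u w = Real.cos γ := by rw [← hγ, cos_angle, hu, hw]; simp
    set a := Real.sin ((1 - s) * γ)
    set b := Real.sin (s * γ)
    have hab : Real.sin γ = b * Real.cos ((1 - s) * γ) + Real.cos (s * γ) * a := by
      rw [← Real.sin_add]; congr 1; ring
    have hcc : Real.cos γ = Real.cos (s * γ) * Real.cos ((1 - s) * γ) - b * a := by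
      rw [← Real.cos_add]; congr 1; ring
    have ha2 : a ^ 2 + Real.cos ((1 - s) * γ) ^ 2 = 1 := Real.sin_sq_add_cos_sq _
    have hb2 : b ^ 2 + Real.cos (s * γ) ^ 2 = 1 := Real.sin_sq_add_cos_sq _
    have hsc : Real.sin γ ^ 2 + Real.cos γ ^ 2 = 1 := Real.sin_sq_add_cos_sq _
    -- The difference has norm zero by the addition formulas for sine and cosine.
    have hkey : ‖Real.sin γ • v - (a • u + b • w)‖ ^ 2 = 0 := by
      rw [@norm_sub_sq_real, @norm_add_sq_real]
      simp only [norm_smul, inner_add_right, real_inner_smul_left, real_inner_smul_right, hu, hv,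
        hw, huw, hvw, real_inner_comm u v, huv, mul_one, Real.norm_eq_abs, sq_abs]
      rw [hcc]
      rw [hcc] at hsc
      rw [hab] at hsc ⊢
      grind
    rw [eq_inv_smul_iff₀ hs.ne']
    exact sub_eq_zero.1 (norm_eq_zero.1 (pow_eq_zero_iff two_ne_zero |>.1 hkey))

/-- On the sphere, a point between two points that are not antipodal is determined by its distances
from them. -/
theorem unique_of_angle_eq_mul {u v v' w : E} {γ s : ℝ} (hu : ‖u‖ = 1) (hv : ‖v‖ = 1)
    (hv' : ‖v'‖ = 1) (hw : ‖w‖ = 1) (hγ : angle u w = γ) (hpi : γ < Real.pi)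
    (h1 : angle u v = s * γ) (h2 : angle v w = (1 - s) * γ)
    (h1' : angle u v' = s * γ) (h2' : angle v' w = (1 - s) * γ) : v = v' := by
  rcases eq_of_angle_eq_mul hu hv hw hγ hpi h1 h2 with h | ⟨h0, h⟩ <;>
    rcases eq_of_angle_eq_mul hu hv' hw hγ hpi h1' h2' with h' | ⟨h0', h'⟩
  · rw [h, h']
  · rw [h, h0'] at hv; simp at hv
  · rw [h', h0] at hv'; simp at hv'
  · rw [h, h']

end Sphere

/-- If `z ≤ x + y` coordinatewise and the Euclidean norms of `x` and `y` are at most `s ‖z‖` and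
`(1 - s) ‖z‖`, then `x` and `y` are these multiples of `z`. -/
theorem eq_smul_of_norm_le {ι : Type*} [Fintype ι] {x y z : EuclideanSpace ℝ ι} {s : ℝ}
    (hz : ∀ i, 0 ≤ z i) (h : ∀ i, z i ≤ x i + y i)
    (hx : ‖x‖ ≤ s * ‖z‖) (hy : ‖y‖ ≤ (1 - s) * ‖z‖) : x = s • z ∧ y = (1 - s) • z := by
  have hzz : ‖z‖ ^ 2 ≤ inner ℝ z (x + y) := by
    rw [EuclideanSpace.norm_sq_eq, PiLp.inner_apply]
    refine Finset.sum_le_sum fun i _ => ?_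
    have h1 := mul_le_mul_of_nonneg_left (h i) (hz i)
    simp only [Real.norm_eq_abs, sq_abs, PiLp.add_apply, RCLike.inner_apply, conj_trivial]
    linarith
  rw [inner_add_right] at hzz
  have hx2 : ‖x‖ ^ 2 ≤ s ^ 2 * ‖z‖ ^ 2 := by
    rw [← mul_pow]; exact pow_le_pow_left₀ (norm_nonneg _) hx 2
  have hy2 : ‖y‖ ^ 2 ≤ (1 - s) ^ 2 * ‖z‖ ^ 2 := by
    rw [← mul_pow]; exact pow_le_pow_left₀ (norm_nonneg _) hy 2
  have hzx : inner ℝ z x ≤ ‖z‖ * (s * ‖z‖) :=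
    (real_inner_le_norm z x).trans (mul_le_mul_of_nonneg_left hx (norm_nonneg _))
  have hzy : inner ℝ z y ≤ ‖z‖ * ((1 - s) * ‖z‖) :=
    (real_inner_le_norm z y).trans (mul_le_mul_of_nonneg_left hy (norm_nonneg _))
  have ex : inner ℝ z x = s * ‖z‖ ^ 2 := le_antisymm (by linarith) (by linarith)
  have ey : inner ℝ z y = (1 - s) * ‖z‖ ^ 2 := le_antisymm (by linarith) (by linarith)
  have key : ∀ (a : EuclideanSpace ℝ ι) (r : ℝ), ‖a‖ ^ 2 ≤ r ^ 2 * ‖z‖ ^ 2 →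
      inner ℝ z a = r * ‖z‖ ^ 2 → a = r • z := by
    intro a r ha hr
    have : ‖a - r • z‖ ^ 2 ≤ 0 := by
      rw [@norm_sub_sq_real, norm_smul, real_inner_smul_right, real_inner_comm, hr, mul_pow,
        Real.norm_eq_abs, sq_abs]
      nlinarith
    have h0 : ‖a - r • z‖ = 0 := by
      have := le_antisymm this (sq_nonneg _)
      simpa using this
    exact sub_eq_zero.1 (norm_eq_zero.1 h0)
  exact ⟨key x s hx2 ex, key y (1 - s) hy2 ey⟩

/-! ### The metrics in matrix entries -/

variable {p : ℕ}

theorem transpose_mul_self_of_mem_SO {U : Mat p} (hU : U ∈ SO p) : Uᵀ * U = 1 := by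
  have := (Matrix.mem_specialOrthogonalGroup_iff.1 hU).1
  rwa [Matrix.mem_orthogonalGroup_iff'] at this

theorem mul_transpose_self_of_mem_SO {U : Mat p} (hU : U ∈ SO p) : U * Uᵀ = 1 :=
  mul_eq_one_comm.1 (transpose_mul_self_of_mem_SO hU)

theorem det_of_mem_SO {U : Mat p} (hU : U ∈ SO p) : U.det = 1 :=
  (Matrix.mem_specialOrthogonalGroup_iff.1 hU).2

theorem mem_SO_of {U : Mat p} (h : Uᵀ * U = 1) (hdet : U.det = 1) : U ∈ SO p :=
  Matrix.mem_specialOrthogonalGroup_iff.2 ⟨(Matrix.mem_orthogonalGroup_iff' _ _).2 h, hdet⟩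

theorem trace_transpose_mul_self (A : Mat p) : (Aᵀ * A).trace = ∑ i, ∑ j, A i j ^ 2 := by
  rw [Finset.sum_comm]
  simp [Matrix.trace, Matrix.mul_apply, sq]

theorem hasDerivWithinAt_entry {f : ℝ → Mat p} {f' : Mat p} {s : Set ℝ} {t : ℝ}
    (h : HasDerivWithinAt f f' s t) (i j : Fin p) :
    HasDerivWithinAt (fun t => f t i j) (f' i j) s t :=
  (LinearMap.toContinuousLinearMap
    (Matrix.entryLinearMap ℝ ℝ i j)).hasFDerivAt.comp_hasDerivWithinAt t h

theorem hasDerivWithinAt_transpose {f : ℝ → Mat p} {f' : Mat p} {s : Set ℝ} {t : ℝ}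
    (h : HasDerivWithinAt f f' s t) : HasDerivWithinAt (fun t => (f t)ᵀ) f'ᵀ s t :=
  (LinearMap.toContinuousLinearMap
    (Matrix.transposeLinearEquiv (Fin p) (Fin p) ℝ ℝ).toLinearMap).hasFDerivAt.comp_hasDerivWithinAt
      t h

/-- Velocities of curves in `SO(p)`, translated to the identity, are skew-symmetric. -/
theorem transpose_transpose_mul_of_hasDerivWithinAt {c : ℝ → Mat p} {A : Mat p} {s : Set ℝ} {t : ℝ}
    (h : HasDerivWithinAt c A s t) (hs : UniqueDiffWithinAt ℝ s t) (ht : t ∈ s)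
    (hc : ∀ z ∈ s, c z ∈ SO p) : ((c t)ᵀ * A)ᵀ = -((c t)ᵀ * A) := by
  have h1 := (hasDerivWithinAt_transpose h).mul h
  have h2 : HasDerivWithinAt (fun t => (c t)ᵀ * c t) 0 s t :=
    (hasDerivWithinAt_const t s (1 : Mat p)).congr_of_mem
      (fun z hz => transpose_mul_self_of_mem_SO (hc z hz)) ht
  have h3 := hs.eq_deriv _ h1 h2
  rw [Matrix.transpose_mul, Matrix.transpose_transpose]
  exact eq_neg_of_add_eq_zero_left h3

theorem isDiag_of_hasDerivWithinAt {δ : ℝ → Mat p} {A : Mat p} {s : Set ℝ} {t : ℝ}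
    (h : HasDerivWithinAt δ A s t) (hs : UniqueDiffWithinAt ℝ s t) (ht : t ∈ s)
    (hδ : ∀ z ∈ s, (δ z).IsDiag) : A.IsDiag := by
  intro i j hij
  refine hs.eq_deriv _ (hasDerivWithinAt_entry h i j) ?_
  exact (hasDerivWithinAt_const t s (0 : ℝ)).congr_of_mem (fun z hz => hδ z hz hij) ht

theorem soMetric_self {U A : Mat p} (hU : U ∈ SO p) (hA : (Uᵀ * A)ᵀ = -(Uᵀ * A)) :
    soMetric U A A = (1 / 2) * ∑ i, ∑ j, A i j ^ 2 := by
  have h : Uᵀ * A * (Uᵀ * A) = -(Aᵀ * A) := by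
    have : Aᵀ * A = (Uᵀ * A)ᵀ * (Uᵀ * A) := by
      rw [Matrix.transpose_mul, Matrix.transpose_transpose, Matrix.mul_assoc,
        ← Matrix.mul_assoc U, mul_transpose_self_of_mem_SO hU, Matrix.one_mul]
    rw [this, hA, Matrix.neg_mul, neg_neg]
  rw [soMetric, h, Matrix.trace_neg, trace_transpose_mul_self]
  ring

theorem diagMetric_self {D L : Mat p} (hD : D ∈ DiagPos p) (hL : L.IsDiag) :
    diagMetric D L L = ∑ j, (L j j / D j j) ^ 2 := by
  obtain ⟨hd, hpos⟩ := hD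
  have hDinv : D⁻¹ = Matrix.diagonal fun j => (D j j)⁻¹ := by
    refine Matrix.inv_eq_left_inv ?_
    nth_rewrite 2 [← hd.diagonal_diag]
    rw [Matrix.diagonal_mul_diagonal, ← Matrix.diagonal_one]
    congr 1
    funext j
    simp [(hpos j).ne']
  rw [diagMetric, hDinv, ← hL.diagonal_diag]
  simp only [Matrix.diagonal_mul_diagonal, Matrix.trace_diagonal, Matrix.diag_apply,
    Matrix.diagonal_apply_eq]
  refine Finset.sum_congr rfl fun j _ => ?_
  ring

/-- The squared speed of a curve in `M(p)` in terms of matrix entries. -/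
theorem metricM_self {k : ℝ} {w : ℝ → Mat p × Mat p} {w' : Mat p × Mat p} {s : Set ℝ} {t : ℝ}
    (h : HasDerivWithinAt w w' s t) (hs : UniqueDiffWithinAt ℝ s t) (ht : t ∈ s)
    (hw : ∀ z ∈ s, w z ∈ M p) :
    metricM k (w t) w' w' =
      k / 2 * ∑ i, ∑ j, w'.1 i j ^ 2 + ∑ j, (w'.2 j j / (w t).2 j j) ^ 2 := by
  rw [metricM, soMetric_self (hw t ht).1, diagMetric_self (hw t ht).2]
  · ring
  · exact isDiag_of_hasDerivWithinAt h.snd hs ht fun z hz => (hw z hz).2.1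
  · exact transpose_transpose_mul_of_hasDerivWithinAt h.fst hs ht fun z hz => (hw z hz).1

/-! ### Comparison with a product of spheres and lines -/

/-- The `i`-th column of `U * Q`, a vector of Euclidean space. -/
def column (Q U : Mat p) (i : Fin p) : EuclideanSpace ℝ (Fin p) :=
  WithLp.toLp 2 fun r => (U * Q) r i

theorem inner_column (Q U V : Mat p) (i : Fin p) :
    inner ℝ (column Q U i) (column Q V i) = (Qᵀ * (Uᵀ * V) * Q) i i := by
  have : Qᵀ * (Uᵀ * V) * Q = (U * Q)ᵀ * (V * Q) := by
    simp only [Matrix.transpose_mul, Matrix.mul_assoc]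
  rw [this]
  simp [column, PiLp.inner_apply, Matrix.mul_apply, mul_comm]

theorem norm_column {Q U : Mat p} (hQ : Qᵀ * Q = 1) (hU : U ∈ SO p) (i : Fin p) :
    ‖column Q U i‖ = 1 := by
  have := inner_column Q U U i
  rw [transpose_mul_self_of_mem_SO hU, Matrix.mul_one, hQ, real_inner_self_eq_norm_sq,
    Matrix.one_apply_eq] at this
  exact (pow_eq_one_iff_of_nonneg (norm_nonneg _) two_ne_zero).1 this

theorem angle_column {Q U V : Mat p} (hQ : Qᵀ * Q = 1) (hU : U ∈ SO p) (hV : V ∈ SO p)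
    (i : Fin p) :
    angle (column Q U i) (column Q V i) = Real.arccos ((Qᵀ * (Uᵀ * V) * Q) i i) := by
  rw [angle, norm_column hQ hU, norm_column hQ hV, inner_column]
  simp

/-- The columns of `A * Q` determine the Frobenius norm of `A`, so the comparison with spheres loses
nothing in the length. -/
theorem sum_norm_column {Q : Mat p} (hQ : Qᵀ * Q = 1) (A : Mat p) :
    ∑ i, ‖column Q A i‖ ^ 2 = ∑ i, ∑ j, A i j ^ 2 := by
  have h1 : ∑ i, ‖column Q A i‖ ^ 2 = (Qᵀ * (Aᵀ * A) * Q).trace := by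
    simp only [← real_inner_self_eq_norm_sq, inner_column, Matrix.trace, Matrix.diag_apply]
  rw [h1, Matrix.trace_mul_comm, ← Matrix.mul_assoc, mul_eq_one_comm.1 hQ, Matrix.one_mul,
    trace_transpose_mul_self]

theorem hasDerivWithinAt_column {c : ℝ → Mat p} {A : Mat p} {s : Set ℝ} {t : ℝ}
    (h : HasDerivWithinAt c A s t) (Q : Mat p) (i : Fin p) :
    HasDerivWithinAt (fun t => column Q (c t) i) (column Q A i) s t := by
  have h1 : HasDerivWithinAt (fun t => fun r => (c t * Q) r i) (fun r => (A * Q) r i) s t :=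
    hasDerivWithinAt_pi.2 fun r => hasDerivWithinAt_entry (h.mul_const Q) r i
  exact (PiLp.continuousLinearEquiv 2 ℝ fun _ : Fin p => ℝ).symm.toContinuousLinearMap.hasFDerivAt
    |>.comp_hasDerivWithinAt t h1

/-- The vector of distances from `a` to `b` in the product of spheres and lines into which `M(p)` is
mapped by the columns of `U * Q` and the logarithms of the diagonal entries. For orthogonal `Q` this
map preserves the lengths of curves, so the norm of `gap k Q a b` bounds the distance in `M(p)` from
below. -/
noncomputable def gap (k : ℝ) (Q : Mat p) (a b : Mat p × Mat p) : EuclideanSpace ℝ (Fin p ⊕ Fin p) :=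
  WithLp.toLp 2 (Sum.elim (fun i => √(k / 2) * angle (column Q a.1 i) (column Q b.1 i))
    fun j => |Real.log (b.2 j j) - Real.log (a.2 j j)|)

theorem gap_inl (k : ℝ) (Q : Mat p) (a b : Mat p × Mat p) (i : Fin p) :
    gap k Q a b (Sum.inl i) = √(k / 2) * angle (column Q a.1 i) (column Q b.1 i) := rfl

theorem gap_inr (k : ℝ) (Q : Mat p) (a b : Mat p × Mat p) (j : Fin p) :
    gap k Q a b (Sum.inr j) = |Real.log (b.2 j j) - Real.log (a.2 j j)| := rfl

theorem gap_nonneg (k : ℝ) (Q : Mat p) (a b : Mat p × Mat p) (i : Fin p ⊕ Fin p) :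
    0 ≤ gap k Q a b i := by
  rcases i with i | j
  · rw [gap_inl]; exact mul_nonneg (Real.sqrt_nonneg _) (angle_nonneg _ _)
  · rw [gap_inr]; exact abs_nonneg _

theorem gap_self (k : ℝ) {Q : Mat p} (hQ : Qᵀ * Q = 1) {a : Mat p × Mat p} (ha : a ∈ M p) :
    gap k Q a a = 0 := by
  ext i
  rcases i with i | j
  · have hn : column Q a.1 i ≠ 0 := by
      rw [← norm_ne_zero_iff, norm_column hQ ha.1]; simp
    simp [gap_inl, angle_self hn]
  · simp [gap_inr]

theorem gap_le_add (k : ℝ) (Q : Mat p) (a b c : Mat p × Mat p) (i : Fin p ⊕ Fin p) :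
    gap k Q a c i ≤ gap k Q a b i + gap k Q b c i := by
  rcases i with i | j
  · simp only [gap_inl, ← mul_add]
    exact mul_le_mul_of_nonneg_left (angle_le_angle_add_angle _ _ _) (Real.sqrt_nonneg _)
  · simp only [gap_inr]
    rw [add_comm]
    exact abs_sub_le _ _ _

theorem norm_gap_le_add (k : ℝ) (Q : Mat p) (a b c : Mat p × Mat p) :
    ‖gap k Q a c‖ ≤ ‖gap k Q a b‖ + ‖gap k Q b c‖ := by
  refine le_trans ?_ (norm_add_le _ _)
  rw [EuclideanSpace.norm_eq, EuclideanSpace.norm_eq]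
  refine Real.sqrt_le_sqrt (Finset.sum_le_sum fun i _ => ?_)
  refine pow_le_pow_left₀ (norm_nonneg _) ?_ 2
  rw [Real.norm_of_nonneg (gap_nonneg k Q a c i)]
  exact (gap_le_add k Q a b c i).trans (le_abs_self _)

theorem norm_gap_sq {k : ℝ} (hk : 0 ≤ k) (Q : Mat p) (a b : Mat p × Mat p) :
    ‖gap k Q a b‖ ^ 2 = k / 2 * ∑ i, angle (column Q a.1 i) (column Q b.1 i) ^ 2 +
      ∑ j, (Real.log (b.2 j j) - Real.log (a.2 j j)) ^ 2 := by
  have : 0 ≤ k / 2 := by positivity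
  simp only [EuclideanSpace.norm_sq_eq, Fintype.sum_sum_type, gap_inl, gap_inr, Real.norm_eq_abs,
    sq_abs, mul_pow, Real.sq_sqrt this, Finset.mul_sum]

/-- The distance in the product of spheres and lines from the starting point of a curve in `M(p)`
grows at the initial rate given by the Riemannian speed. -/
theorem hasDerivWithinAt_norm_gap {k : ℝ} (hk : 0 ≤ k) {Q : Mat p} (hQ : Qᵀ * Q = 1)
    {w : ℝ → Mat p × Mat p} {w' : Mat p × Mat p} {t : ℝ}
    (h : HasDerivWithinAt w w' (Set.Ioi t) t) (h1 : w t ∈ M p)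
    (hw : ∀ᶠ z in 𝓝[>] t, w z ∈ M p) :
    HasDerivWithinAt (fun z => ‖gap k Q (w t) (w z)‖)
      √(k / 2 * ∑ i, ∑ j, w'.1 i j ^ 2 + ∑ j, (w'.2 j j / (w t).2 j j) ^ 2) (Set.Ioi t) t := by
  have hzero := gap_self k hQ h1
  let g' : Fin p ⊕ Fin p → ℝ :=
    Sum.elim (fun i => √(k / 2) * ‖column Q w'.1 i‖) fun j => |w'.2 j j / (w t).2 j j|
  have hg : HasDerivWithinAt (fun z => gap k Q (w t) (w z)) (WithLp.toLp 2 g') (Set.Ioi t) t := by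
    have hpi : HasDerivWithinAt (fun z => (gap k Q (w t) (w z)).ofLp) g' (Set.Ioi t) t := by
      rw [hasDerivWithinAt_pi]
      rintro (i | j)
      · refine (hasDerivWithinAt_angle (hasDerivWithinAt_column h.fst Q i)
          (norm_column hQ h1.1 i) ?_).const_mul _
        filter_upwards [hw] with z hz using norm_column hQ hz.1 i
      · exact hasDerivWithinAt_norm_sub
          ((hasDerivWithinAt_entry h.snd j j).log (h1.2.2 j).ne')
    exact (PiLp.continuousLinearEquiv 2 ℝ
      fun _ : Fin p ⊕ Fin p => ℝ).symm.toContinuousLinearMap.hasFDerivAt.comp_hasDerivWithinAt t hpi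
  have hn := hasDerivWithinAt_norm_sub hg
  simp only [hzero, sub_zero] at hn
  convert hn using 1
  have hk2 : 0 ≤ k / 2 := by positivity
  rw [EuclideanSpace.norm_eq, ← sum_norm_column hQ]
  simp only [g', Fintype.sum_sum_type, Sum.elim_inl, Sum.elim_inr, mul_pow,
    Real.norm_eq_abs, sq_abs, Real.sq_sqrt hk2, Finset.mul_sum]

/-! ### Lower bounds for lengths, and uniqueness of shortest curves -/

theorem curveLength_nonneg {E : Type*} [NormedAddCommGroup E] [NormedSpace ℝ E]
    (g : E → E → E → ℝ) (c : ℝ → E) {a b : ℝ} (hab : a ≤ b) : 0 ≤ curveLength g c a b :=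
  intervalIntegral.integral_nonneg hab fun _ _ => Real.sqrt_nonneg _

/-- The lower bound for a smooth piece, together with the integrability of its speed. -/
theorem norm_gap_le_curveLength_of_contDiffOn {k : ℝ} (hk : 0 ≤ k) {Q : Mat p} (hQ : Qᵀ * Q = 1)
    {w : ℝ → Mat p × Mat p} {x y : ℝ} (hxy : x < y) (h : ContDiffOn ℝ ∞ w (Set.Icc x y))
    (hw : ∀ t ∈ Set.Icc x y, w t ∈ M p) :
    IntervalIntegrable (fun t => √(metricM k (w t) (deriv w t) (deriv w t))) volume x y ∧
      ‖gap k Q (w x) (w y)‖ ≤ curveLength (metricM k) w x y := by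
  have hu : UniqueDiffOn ℝ (Set.Icc x y) := uniqueDiffOn_Icc hxy
  set W : ℝ → Mat p × Mat p := fun t => derivWithin w (Set.Icc x y) t with hWdef
  have hW : ContinuousOn W (Set.Icc x y) := h.continuousOn_derivWithin hu (by simp)
  have hd : ∀ t ∈ Set.Icc x y, HasDerivWithinAt w (W t) (Set.Icc x y) t := fun t ht =>
    (h.differentiableOn (by simp) t ht).hasDerivWithinAt
  set σ : ℝ → ℝ := fun t =>
    √(k / 2 * ∑ i, ∑ j, (W t).1 i j ^ 2 + ∑ j, ((W t).2 j j / (w t).2 j j) ^ 2) with hσdef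
  have entry : ∀ i j : Fin p, Continuous fun A : Mat p => A i j := fun i j =>
    (LinearMap.toContinuousLinearMap (Matrix.entryLinearMap ℝ ℝ i j)).continuous
  have hσ : ContinuousOn σ (Set.Icc x y) := by
    refine Real.continuous_sqrt.comp_continuousOn ?_
    refine ContinuousOn.add (continuousOn_const.mul ?_) ?_
    · exact continuousOn_finsetSum _ fun i _ => continuousOn_finsetSum _ fun j _ =>
        ((entry i j).comp_continuousOn (continuous_fst.comp_continuousOn hW)).pow 2
    · refine continuousOn_finsetSum _ fun j _ => (ContinuousOn.div ?_ ?_ ?_).pow 2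
      · exact (entry j j).comp_continuousOn (continuous_snd.comp_continuousOn hW)
      · exact (entry j j).comp_continuousOn (continuous_snd.comp_continuousOn h.continuousOn)
      · exact fun t ht => ((hw t ht).2.2 j).ne'
  -- The speed of `w`, from one-sided derivatives at the ends, extended continuously to the line.
  set S : ℝ → ℝ := Set.IccExtend hxy.le ((Set.Icc x y).domRestrict σ) with hSdef
  have hS : Continuous S := hσ.domRestrict.Icc_extend'
  have hSσ : ∀ t ∈ Set.Icc x y, S t = σ t := fun t ht => by
    rw [hSdef, Set.IccExtend_of_mem _ _ ht, Set.domRestrict_apply]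
  have hspeed : Set.EqOn (fun t => √(metricM k (w t) (deriv w t) (deriv w t))) S
      (Set.Ioo x y) := by
    intro t ht
    have ht' := Set.Ioo_subset_Icc_self ht
    have : deriv w t = W t := (derivWithin_of_mem_nhds (Icc_mem_nhds ht.1 ht.2)).symm
    simp only [this]
    rw [hSσ t ht', metricM_self (hd t ht') (hu t ht') ht' hw]
  refine ⟨?_, ?_⟩
  · refine (intervalIntegrable_congr_uIoo ?_).2 (hS.intervalIntegrable x y)
    rwa [Set.uIoo_of_le hxy.le]
  refine le_of_le_of_eq ?_ (intervalIntegral.integral_congr_Ioo_of_le hxy.le hspeed).symm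
  -- The distance from the initial point cannot grow faster than the length of the curve.
  have hIoi : ∀ t ∈ Set.Ico x y, HasDerivWithinAt w (W t) (Set.Ioi t) t := fun t ht =>
    (hd t (Set.Ico_subset_Icc_self ht)).mono_of_mem_nhdsWithin
      (mem_of_superset (Ioo_mem_nhdsGT ht.2) fun z hz => ⟨ht.1.trans hz.1.le, hz.2.le⟩)
  have hev : ∀ t ∈ Set.Ico x y, ∀ᶠ z in 𝓝[>] t, w z ∈ M p := fun t ht =>
    mem_of_superset (Ioo_mem_nhdsGT ht.2) fun z hz => hw z ⟨ht.1.trans hz.1.le, hz.2.le⟩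
  have hx : x ∈ Set.Icc x y := Set.left_mem_Icc.2 hxy.le
  have hcont : ContinuousOn (fun z => ‖gap k Q (w x) (w z)‖) (Set.Icc x y) := by
    refine ContinuousOn.norm ?_
    refine (PiLp.continuousLinearEquiv 2 ℝ
      fun _ : Fin p ⊕ Fin p => ℝ).symm.continuous.comp_continuousOn ?_
    refine continuousOn_pi.2 ?_
    rintro (i | j)
    · intro z hz
      refine ContinuousWithinAt.mul continuousWithinAt_const ?_
      have h1 : column Q (w x).1 i ≠ 0 := by
        rw [← norm_ne_zero_iff, norm_column hQ (hw x hx).1]; simp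
      have h2 : column Q (w z).1 i ≠ 0 := by
        rw [← norm_ne_zero_iff, norm_column hQ (hw z hz).1]; simp
      have hc : ContinuousWithinAt (fun z => column Q (w z).1 i) (Set.Icc x y) z :=
        (hasDerivWithinAt_column (hd z hz).fst Q i).continuousWithinAt
      exact ContinuousAt.comp_continuousWithinAt (f := fun z => (column Q (w x).1 i,
        column Q (w z).1 i)) (continuousAt_angle (x := (_, _)) h1 h2)
          (continuousWithinAt_const.prodMk hc)
    · refine ContinuousOn.abs (ContinuousOn.sub (ContinuousOn.log ?_ ?_) continuousOn_const)
      · exact (entry j j).comp_continuousOn (continuous_snd.comp_continuousOn h.continuousOn)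
      · exact fun t ht => ((hw t ht).2.2 j).ne'
  refine image_le_of_liminf_slope_right_le_deriv_boundary (B := fun z => ∫ t in x..z, S t)
    (B' := S) hcont ?_ ?_ ?_ ?_ (Set.right_mem_Icc.2 hxy.le)
  · simp [gap_self k hQ (hw x hx)]
  · exact fun z _ => (hS.integral_hasStrictDerivAt x z).hasDerivAt.continuousAt.continuousWithinAt
  · exact fun z _ => (hS.integral_hasStrictDerivAt x z).hasDerivAt.hasDerivWithinAt
  · intro t ht r hr
    rw [hSσ t (Set.Ico_subset_Icc_self ht)] at hr
    have hN := hasDerivWithinAt_norm_gap hk hQ (hIoi t ht) (hw t (Set.Ico_subset_Icc_self ht))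
      (hev t ht)
    rw [hasDerivWithinAt_iff_tendsto_slope' (by simp)] at hN
    refine Eventually.frequently ?_
    filter_upwards [hN.eventually_lt_const hr, self_mem_nhdsWithin] with z hz hzt
    refine lt_of_le_of_lt ?_ hz
    have hz' : 0 < z - t := sub_pos.2 hzt
    rw [slope_def_field, slope_def_field]
    refine div_le_div_of_nonneg_right ?_ hz'.le
    have h1 := norm_gap_le_add k Q (w x) (w t) (w z)
    rw [gap_self k hQ (hw t (Set.Ico_subset_Icc_self ht)), norm_zero]
    linarith

/-- The distance in the product of spheres and lines is a lower bound for lengths in `M(p)`. -/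
theorem norm_gap_le_curveLength {k : ℝ} (hk : 0 ≤ k) {Q : Mat p} (hQ : Qᵀ * Q = 1)
    {w : ℝ → Mat p × Mat p} {a b : ℝ} (h : IsCurveIn (M p) w a b) {x y : ℝ} (hax : a ≤ x)
    (hxy : x ≤ y) (hyb : y ≤ b) : ‖gap k Q (w x) (w y)‖ ≤ curveLength (metricM k) w x y := by
  obtain ⟨⟨-, B, hB⟩, hw⟩ := h
  -- Induction on the number of interior break points.
  have main : ∀ n : ℕ, ∀ x y : ℝ, a ≤ x → x < y → y ≤ b →
      (B.filter fun z => z ∈ Set.Ioo x y).card ≤ n →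
      IntervalIntegrable (fun t => √(metricM k (w t) (deriv w t) (deriv w t))) volume x y ∧
        ‖gap k Q (w x) (w y)‖ ≤ curveLength (metricM k) w x y := by
    intro n
    induction n with
    | zero =>
      intro x y hax hxy hyb hn
      refine norm_gap_le_curveLength_of_contDiffOn hk hQ hxy (hB x y hax hxy hyb ?_)
        fun t ht => hw t ⟨hax.trans ht.1, ht.2.trans hyb⟩
      intro z hz hz'
      rw [Nat.le_zero, Finset.card_eq_zero, Finset.filter_eq_empty_iff] at hn
      exact hn hz hz'
    | succ n ih =>
      intro x y hax hxy hyb hn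
      by_cases he : ∃ z ∈ B, z ∈ Set.Ioo x y
      · obtain ⟨z, hzB, hz⟩ := he
        have sub : ∀ x' y' : ℝ, x ≤ x' → y' ≤ y → z ∉ Set.Ioo x' y' →
            (B.filter fun z => z ∈ Set.Ioo x' y').card ≤ n := by
          intro x' y' hx' hy' hzn
          refine Nat.le_of_lt_succ (lt_of_lt_of_le (Finset.card_lt_card ?_) hn)
          refine Finset.ssubset_iff_subset_ne.2 ⟨?_, fun heq => ?_⟩
          · intro u hu
            rw [Finset.mem_filter] at hu ⊢
            exact ⟨hu.1, hx'.trans_lt hu.2.1, hu.2.2.trans_le hy'⟩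
          · have : z ∈ B.filter fun z => z ∈ Set.Ioo x y := Finset.mem_filter.2 ⟨hzB, hz⟩
            rw [← heq, Finset.mem_filter] at this
            exact hzn this.2
        obtain ⟨i1, l1⟩ := ih x z hax hz.1 (hz.2.le.trans hyb) (sub x z le_rfl hz.2.le (by simp))
        obtain ⟨i2, l2⟩ := ih z y (hax.trans hz.1.le) hz.2 hyb (sub z y hz.1.le le_rfl (by simp))
        refine ⟨i1.trans i2, (norm_gap_le_add k Q _ (w z) _).trans ?_⟩
        have hadd : curveLength (metricM k) w x z + curveLength (metricM k) w z y =
            curveLength (metricM k) w x y := intervalIntegral.integral_add_adjacent_intervals i1 i2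
        linarith
      · push Not at he
        exact norm_gap_le_curveLength_of_contDiffOn hk hQ hxy (hB x y hax hxy hyb he)
          fun t ht => hw t ⟨hax.trans ht.1, ht.2.trans hyb⟩
  rcases hxy.eq_or_lt with rfl | hlt
  · rw [gap_self k hQ (hw x ⟨hax, hyb⟩), norm_zero]
    exact curveLength_nonneg _ _ le_rfl
  · exact (main _ x y hax hlt hyb le_rfl).2

/-- A curve of constant speed that attains the lower bound divides each distance in the product of
spheres and lines proportionally. -/
theorem gap_eq_smul_of_curveLength_le {k : ℝ} (hk : 0 ≤ k) {Q : Mat p} (hQ : Qᵀ * Q = 1)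
    {w : ℝ → Mat p × Mat p} (h : IsCurveIn (M p) w 0 1)
    (hs : HasConstantSpeed (metricM k) w 0 1)
    (hlen : curveLength (metricM k) w 0 1 ≤ ‖gap k Q (w 0) (w 1)‖) {t : ℝ} (h0 : 0 ≤ t)
    (h1 : t ≤ 1) :
    gap k Q (w 0) (w t) = t • gap k Q (w 0) (w 1) ∧
      gap k Q (w t) (w 1) = (1 - t) • gap k Q (w 0) (w 1) := by
  obtain ⟨v, hv⟩ := hs
  have hv1 := hv 0 1 le_rfl zero_le_one le_rfl
  rw [sub_zero, mul_one] at hv1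
  have e1 := norm_gap_le_curveLength hk hQ h le_rfl h0 h1
  have e2 := norm_gap_le_curveLength hk hQ h h0 h1 le_rfl
  rw [hv 0 t le_rfl h0 h1, sub_zero, mul_comm] at e1
  rw [hv t 1 h0 h1 le_rfl, mul_comm] at e2
  rw [hv1] at hlen
  refine eq_smul_of_norm_le (gap_nonneg k Q _ _) (gap_le_add k Q _ _ _)
    (e1.trans (mul_le_mul_of_nonneg_left hlen h0))
    (e2.trans (mul_le_mul_of_nonneg_left hlen (sub_nonneg.2 h1)))

theorem eq_of_mul_right_eq {Q A B : Mat p} (hQ : Qᵀ * Q = 1) (h : A * Q = B * Q) : A = B := by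
  have hQ' := mul_eq_one_comm.1 hQ
  rw [← Matrix.mul_one A, ← Matrix.mul_one B, ← hQ', ← Matrix.mul_assoc, h, Matrix.mul_assoc]

/-- A point of `M(p)` that divides all distances between `a` and `b` in the same ratio is determined
by that ratio, provided that no column of `a.1 * Q` is antipodal to that of `b.1 * Q`. -/
theorem eq_of_gap_eq_smul {k : ℝ} (hk : 0 < k) {Q : Mat p} (hQ : Qᵀ * Q = 1)
    {a b x x' : Mat p × Mat p} (ha : a ∈ M p) (hb : b ∈ M p) (hx : x ∈ M p) (hx' : x' ∈ M p)
    (hpi : ∀ i, angle (column Q a.1 i) (column Q b.1 i) < Real.pi) {t : ℝ}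
    (h1 : gap k Q a x = t • gap k Q a b) (h2 : gap k Q x b = (1 - t) • gap k Q a b)
    (h1' : gap k Q a x' = t • gap k Q a b) (h2' : gap k Q x' b = (1 - t) • gap k Q a b) :
    x = x' := by
  have hk2 : √(k / 2) ≠ 0 := (Real.sqrt_pos.2 (by positivity)).ne'
  have hang : ∀ {u v : Mat p × Mat p} {r : ℝ}, gap k Q u v = r • gap k Q a b → ∀ i,
      angle (column Q u.1 i) (column Q v.1 i) = r * angle (column Q a.1 i) (column Q b.1 i) := by
    intro u v r h i
    have := congrArg (fun f => f (Sum.inl i)) h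
    simp only [PiLp.smul_apply, gap_inl, smul_eq_mul] at this
    exact mul_left_cancel₀ hk2 (by linarith)
  have hlog : ∀ {u v : Mat p × Mat p} {r : ℝ}, gap k Q u v = r • gap k Q a b → ∀ j,
      (Real.log (v.2 j j) - Real.log (u.2 j j)) ^ 2 =
        r ^ 2 * (Real.log (b.2 j j) - Real.log (a.2 j j)) ^ 2 := by
    intro u v r h j
    have := congrArg (fun f => f (Sum.inr j)) h
    simp only [PiLp.smul_apply, gap_inr, smul_eq_mul] at this
    rw [← sq_abs, this, mul_pow, sq_abs]
  have log_eq : ∀ {z : Mat p × Mat p}, gap k Q a z = t • gap k Q a b →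
      gap k Q z b = (1 - t) • gap k Q a b → ∀ j, Real.log (z.2 j j) =
        Real.log (a.2 j j) + t * (Real.log (b.2 j j) - Real.log (a.2 j j)) := by
    intro z hz1 hz2 j
    have e1 := hlog hz1 j
    have e2 := hlog hz2 j
    -- The coordinates of `a`, `z`, `b` satisfy `(z - a)² = t² (b - a)²` and
    -- `(b - z)² = (1 - t)² (b - a)²`, which combine to a perfect square.
    have : (Real.log (z.2 j j) - (Real.log (a.2 j j) +
        t * (Real.log (b.2 j j) - Real.log (a.2 j j)))) ^ 2 = 0 := by
      linear_combination (1 - t) * e1 + t * e2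
    exact sub_eq_zero.1 (pow_eq_zero_iff two_ne_zero |>.1 this)
  refine Prod.ext (eq_of_mul_right_eq hQ ?_) ?_
  · ext r i
    have := unique_of_angle_eq_mul (norm_column hQ ha.1 i) (norm_column hQ hx.1 i)
      (norm_column hQ hx'.1 i) (norm_column hQ hb.1 i) rfl (hpi i) (hang h1 i) (hang h2 i)
      (hang h1' i) (hang h2' i)
    exact congrArg (fun f => f r) this
  · rw [← hx.2.1.diagonal_diag, ← hx'.2.1.diagonal_diag]
    congr 1
    funext j
    exact Real.log_injOn_pos (hx.2.2 j) (hx'.2.2 j)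
      ((log_eq h1 h2 j).trans (log_eq h1' h2' j).symm)

/-- Curves of constant speed that attain the lower bound are unique, unless some column has to move
to its antipode. -/
theorem eqOn_of_curveLength_le {k : ℝ} (hk : 0 < k) {Q : Mat p} (hQ : Qᵀ * Q = 1)
    {a b : Mat p × Mat p} (hpi : ∀ i, angle (column Q a.1 i) (column Q b.1 i) < Real.pi)
    {w w' : ℝ → Mat p × Mat p} (h : IsCurveIn (M p) w 0 1)
    (hs : HasConstantSpeed (metricM k) w 0 1) (h0 : w 0 = a) (h1 : w 1 = b)
    (hlen : curveLength (metricM k) w 0 1 ≤ ‖gap k Q a b‖)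
    (h' : IsCurveIn (M p) w' 0 1) (hs' : HasConstantSpeed (metricM k) w' 0 1) (h0' : w' 0 = a)
    (h1' : w' 1 = b) (hlen' : curveLength (metricM k) w' 0 1 ≤ ‖gap k Q a b‖) :
    Set.EqOn w w' (Set.Icc 0 1) := by
  subst h0 h1
  intro t ht
  have e := gap_eq_smul_of_curveLength_le hk.le hQ h hs hlen ht.1 ht.2
  have e' := gap_eq_smul_of_curveLength_le hk.le hQ h' hs' (by rwa [h0', h1']) ht.1 ht.2
  rw [h0', h1'] at e'
  exact eq_of_gap_eq_smul hk hQ (h.2 0 (by simp)) (h.2 1 (by simp)) (h.2 t ht) (h'.2 t ht) hpi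
    e.1 e.2 e'.1 e'.2

/-! ### Adapted bases -/

/-- The columns of `Q` form an orthonormal basis of eigenvectors of `R + Rᵀ`. -/
def IsAdapted (R Q : Mat p) : Prop :=
  Qᵀ * Q = 1 ∧ ∀ i j, i ≠ j → (Qᵀ * R * Q) i j = -(Qᵀ * R * Q) j i

theorem exists_isAdapted (R : Mat p) : ∃ Q, IsAdapted R Q := by
  have hS : (R + Rᵀ).IsHermitian := by
    rw [Matrix.IsHermitian, Matrix.conjTranspose_eq_transpose_of_trivial, Matrix.transpose_add,
      Matrix.transpose_transpose, add_comm]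
  set Q : Mat p := hS.eigenvectorUnitary.val with hQdef
  have hQ : Qᵀ * Q = 1 := by
    have := Unitary.coe_star_mul_self hS.eigenvectorUnitary
    rwa [Matrix.star_eq_conjTranspose, Matrix.conjTranspose_eq_transpose_of_trivial] at this
  refine ⟨Q, hQ, fun i j hij => ?_⟩
  have hspec := hS.spectral_theorem
  rw [Unitary.conjStarAlgAut_apply, Matrix.star_eq_conjTranspose,
    Matrix.conjTranspose_eq_transpose_of_trivial, ← hQdef] at hspec
  have hd : Qᵀ * (R + Rᵀ) * Q = Matrix.diagonal (RCLike.ofReal ∘ hS.eigenvalues) := by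
    calc Qᵀ * (R + Rᵀ) * Q
        = Qᵀ * (Q * Matrix.diagonal (RCLike.ofReal ∘ hS.eigenvalues) * Qᵀ) * Q := by rw [← hspec]
      _ = (Qᵀ * Q) * Matrix.diagonal (RCLike.ofReal ∘ hS.eigenvalues) * (Qᵀ * Q) := by
          simp only [Matrix.mul_assoc]
      _ = _ := by rw [hQ, Matrix.one_mul, Matrix.mul_one]
  have ht : Qᵀ * Rᵀ * Q = (Qᵀ * R * Q)ᵀ := by
    simp only [Matrix.transpose_mul, Matrix.transpose_transpose, Matrix.mul_assoc]
  rw [Matrix.mul_add, Matrix.add_mul, ht] at hd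
  have := congrFun (congrFun hd i) j
  rw [Matrix.diagonal_apply_ne _ hij, Matrix.add_apply, Matrix.transpose_apply] at this
  linarith

theorem conj_mem_SO {R Q : Mat p} (hR : R ∈ SO p) (hQ : Qᵀ * Q = 1) : Qᵀ * R * Q ∈ SO p := by
  have hQ' := mul_eq_one_comm.1 hQ
  refine mem_SO_of ?_ ?_
  · calc (Qᵀ * R * Q)ᵀ * (Qᵀ * R * Q) = Qᵀ * (Rᵀ * (Q * Qᵀ) * R) * Q := by
          simp only [Matrix.transpose_mul, Matrix.transpose_transpose, Matrix.mul_assoc]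
      _ = 1 := by rw [hQ', Matrix.mul_one, transpose_mul_self_of_mem_SO hR, Matrix.mul_one, hQ]
  · have := congrArg Matrix.det hQ
    rw [Matrix.det_mul, Matrix.det_one] at this
    rw [Matrix.det_mul, Matrix.det_mul, det_of_mem_SO hR, mul_one, this]

theorem sum_sq_col_of_mem_SO {R : Mat p} (hR : R ∈ SO p) (i : Fin p) : ∑ r, R r i ^ 2 = 1 := by
  have := congrFun (congrFun (transpose_mul_self_of_mem_SO hR) i) i
  rw [Matrix.mul_apply, Matrix.one_apply_eq] at this
  simpa [sq] using this

theorem sum_sq_row_of_mem_SO {R : Mat p} (hR : R ∈ SO p) (i : Fin p) : ∑ r, R i r ^ 2 = 1 := by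
  have := congrFun (congrFun (mul_transpose_self_of_mem_SO hR) i) i
  rw [Matrix.mul_apply, Matrix.one_apply_eq] at this
  simpa [sq] using this

theorem diag_mem_Icc_of_mem_SO {R : Mat p} (hR : R ∈ SO p) (i : Fin p) :
    R i i ∈ Set.Icc (-1 : ℝ) 1 := by
  have h1 := Finset.single_le_sum (f := fun r => R r i ^ 2) (fun r _ => sq_nonneg _)
    (Finset.mem_univ i)
  rw [sum_sq_col_of_mem_SO hR i] at h1
  exact ⟨by nlinarith, by nlinarith⟩

/-- The eigenvalue `-1` of a rotation is at least double: if `-1` occurs on the diagonal of a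
rotation whose symmetric part is diagonal, then it occurs at least twice. -/
theorem exists_ne_diag_eq_neg_one {R : Mat p} (hR : R ∈ SO p)
    (hoff : ∀ i j, i ≠ j → R i j = -R j i) {i : Fin p} (hi : R i i = -1) :
    ∃ j, j ≠ i ∧ R j j = -1 := by
  have hrow : ∀ r, r ≠ i → R i r = 0 := by
    intro r hr
    have h := Finset.add_le_sum (f := fun r => R i r ^ 2) (fun r _ => sq_nonneg _)
      (Finset.mem_univ i) (Finset.mem_univ r) hr.symm
    rw [sum_sq_row_of_mem_SO hR, hi] at h
    nlinarith
  -- Composing with the reflection in the `i`-th coordinate gives determinant `-1`, so that the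
  -- composition has an eigenvector for the eigenvalue `-1`.
  set H : Mat p := Matrix.diagonal fun r => if r = i then -1 else 1 with hH
  have hHH : H * H = 1 := by
    rw [hH, Matrix.diagonal_mul_diagonal, ← Matrix.diagonal_one]
    congr 1
    funext r
    split_ifs <;> simp
  have hHt : Hᵀ = H := Matrix.diagonal_transpose _
  have hHdet : H.det = -1 := by
    rw [hH, Matrix.det_diagonal, Finset.prod_ite_eq']
    simp
  have hdet : (1 + R * H).det = 0 := by
    have h1 : (R * H) * (R * H)ᵀ = 1 := by
      rw [Matrix.transpose_mul, hHt, Matrix.mul_assoc, ← Matrix.mul_assoc H, hHH, Matrix.one_mul,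
        mul_transpose_self_of_mem_SO hR]
    have h2 : 1 + R * H = (R * H) * (1 + R * H)ᵀ := by
      rw [Matrix.transpose_add, Matrix.transpose_one, Matrix.mul_add, h1, Matrix.mul_one, add_comm]
    have h3 := congrArg Matrix.det h2
    rw [Matrix.det_mul, Matrix.det_transpose, Matrix.det_mul, det_of_mem_SO hR, hHdet] at h3
    linarith
  obtain ⟨f, hf0, hf⟩ := Matrix.exists_mulVec_eq_zero_iff.2 hdet
  rw [Matrix.add_mulVec, Matrix.one_mulVec, ← Matrix.mulVec_mulVec] at hf
  have hcoord : ∀ r, f r + (R *ᵥ (H *ᵥ f)) r = 0 := fun r => congrFun hf r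
  have hfi : f i = 0 := by
    have h := hcoord i
    have hs : (R *ᵥ (H *ᵥ f)) i = f i := by
      rw [Matrix.mulVec, dotProduct, Finset.sum_eq_single i]
      · rw [hi, hH, Matrix.mulVec_diagonal]; simp
      · intro r _ hr; rw [hrow r hr, zero_mul]
      · simp
    linarith
  have hHf : H *ᵥ f = f := by
    funext r
    rw [hH, Matrix.mulVec_diagonal]
    split_ifs with h
    · rw [h, hfi]; simp
    · simp
  rw [hHf] at hcoord
  have hRf : R *ᵥ f = -f := by
    funext r; have := hcoord r; rw [Pi.neg_apply]; linarith
  have hRtf : Rᵀ *ᵥ f = -f := by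
    have : Rᵀ *ᵥ (R *ᵥ f) = f := by
      rw [Matrix.mulVec_mulVec, transpose_mul_self_of_mem_SO hR, Matrix.one_mulVec]
    rw [hRf, Matrix.mulVec_neg] at this
    rw [← neg_neg (Rᵀ *ᵥ f), this]
  obtain ⟨j, hj⟩ : ∃ j, f j ≠ 0 := by
    by_contra! h
    exact hf0 (funext h)
  refine ⟨j, fun h => hj (h ▸ hfi), ?_⟩
  have hsum : (R + Rᵀ) *ᵥ f = -f + -f := by rw [Matrix.add_mulVec, hRf, hRtf]
  have hsj := congrFun hsum j
  rw [Matrix.mulVec, dotProduct, Finset.sum_eq_single j] at hsj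
  · simp only [Matrix.add_apply, Matrix.transpose_apply, Pi.add_apply, Pi.neg_apply] at hsj
    exact mul_right_cancel₀ hj (by linarith)
  · intro r _ hr
    rw [Matrix.add_apply, Matrix.transpose_apply, hoff j r hr.symm]
    simp
  · simp

/-! ### Explicit geodesics -/

section Rotation

variable {R : Mat p}

/-- If a rotation has a diagonal symmetric part `C` and the skew part `K`, then `K` commutes with
`C`, stated here in entries, and `C ^ 2 - K ^ 2 = 1`. -/
theorem skew_part_identities (hR : R ∈ SO p) (hoff : ∀ i j, i ≠ j → R i j = -R j i) :
    (R - Matrix.diagonal R.diag)ᵀ = -(R - Matrix.diagonal R.diag) ∧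
    (∀ i j, (R - Matrix.diagonal R.diag) i j = 0 ∨ R i i = R j j) ∧
    (R - Matrix.diagonal R.diag) * (R - Matrix.diagonal R.diag) =
      Matrix.diagonal fun i => R i i ^ 2 - 1 := by
  set C : Mat p := Matrix.diagonal R.diag with hC
  set K : Mat p := R - C with hK
  have hKt : Kᵀ = -K := by
    ext i j
    by_cases hij : i = j
    · subst hij; simp [hK, hC]
    · have h1 := Matrix.diagonal_apply_ne R.diag hij
      have h2 := Matrix.diagonal_apply_ne R.diag (Ne.symm hij)
      rw [Matrix.transpose_apply, Matrix.neg_apply, hK, Matrix.sub_apply, Matrix.sub_apply, hC,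
        h1, h2, hoff i j hij]
      ring
  have hRC : R = C + K := by rw [hK]; abel
  have hRt : Rᵀ = C - K := by
    rw [hRC, Matrix.transpose_add, hKt, hC, Matrix.diagonal_transpose, sub_eq_add_neg]
  have e1 := transpose_mul_self_of_mem_SO hR
  have e2 := mul_transpose_self_of_mem_SO hR
  rw [hRt] at e1 e2
  have e1' : (C - K) * (C + K) = 1 := by rw [← hRC]; exact e1
  have e2' : (C + K) * (C - K) = 1 := by rw [← hRC]; exact e2
  have hcomm : C * K = K * C := by
    have h : (2 : ℝ) • (C * K - K * C) = 0 := by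
      rw [two_smul]
      have := e1'.trans e2'.symm
      rw [← sub_eq_zero] at this
      rw [← this]
      noncomm_ring
    exact sub_eq_zero.1 ((smul_eq_zero.1 h).resolve_left two_ne_zero)
  refine ⟨hKt, fun i j => ?_, ?_⟩
  · have h := congrFun (congrFun hcomm i) j
    rw [hC, Matrix.diagonal_mul, Matrix.mul_diagonal, Matrix.diag_apply, Matrix.diag_apply] at h
    have h' : K i j * (R i i - R j j) = 0 := by linear_combination h
    rcases mul_eq_zero.1 h' with h | h
    · exact Or.inl h
    · exact Or.inr (sub_eq_zero.1 h)
  · have h : C * C - K * K = 1 := by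
      rw [← e1']
      have : (C - K) * (C + K) = C * C - K * K + (C * K - K * C) := by noncomm_ring
      rw [this, hcomm, sub_self, add_zero]
    have : K * K = C * C - 1 := by rw [← h]; abel
    rw [this, hC, Matrix.diagonal_mul_diagonal, ← Matrix.diagonal_one, Matrix.diagonal_sub]
    congr 1
    funext i
    simp [sq]

/-- If `K` is the skew part of `R` and `a`, `b` are functions of the symmetric part, then
`a + K b` is a multiple of an isometry on each eigenspace of the symmetric part. -/
theorem transpose_mul_self_diagonal_add (hR : R ∈ SO p) (hoff : ∀ i j, i ≠ j → R i j = -R j i)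
    (a b : ℝ → ℝ) :
    (Matrix.diagonal (fun i => a (R i i)) +
        (R - Matrix.diagonal R.diag) * Matrix.diagonal fun i => b (R i i))ᵀ *
      (Matrix.diagonal (fun i => a (R i i)) +
        (R - Matrix.diagonal R.diag) * Matrix.diagonal fun i => b (R i i)) =
      Matrix.diagonal fun i => a (R i i) ^ 2 + b (R i i) ^ 2 * (1 - R i i ^ 2) := by
  obtain ⟨hKt, hK, hKK⟩ := skew_part_identities hR hoff
  set K : Mat p := R - Matrix.diagonal R.diag
  set A : Mat p := Matrix.diagonal fun i => a (R i i) with hA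
  set B : Mat p := Matrix.diagonal fun i => b (R i i) with hB
  have hAt : Aᵀ = A := Matrix.diagonal_transpose _
  have hBt : Bᵀ = B := Matrix.diagonal_transpose _
  have hAB : A * K * B = B * K * A := by
    ext i j
    rw [hA, hB, Matrix.mul_diagonal, Matrix.diagonal_mul, Matrix.mul_diagonal, Matrix.diagonal_mul]
    rcases hK i j with h | h
    · rw [h]; ring
    · rw [h]; ring
  have : (A + K * B)ᵀ * (A + K * B) = A * A - B * (K * K) * B + (A * K * B - B * K * A) := by
    rw [Matrix.transpose_add, Matrix.transpose_mul, hAt, hBt, hKt]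
    noncomm_ring
  rw [this, hAB, sub_self, add_zero, hKK, hA, hB]
  simp only [Matrix.diagonal_mul_diagonal, Matrix.diagonal_sub]
  congr 1
  funext i
  ring

/-- The geodesic in `SO(p)` from the identity to a rotation `R` whose symmetric part is diagonal: the
rotation angles `arccos (R i i)` are multiplied by `t`. Since `R i i = 1` makes the `i`-th column of
the skew part vanish, the value `0 / 0 = 0` in the second summand does no harm. -/
noncomputable def rotationCurve (R : Mat p) (t : ℝ) : Mat p :=
  Matrix.diagonal (fun i => Real.cos (t * Real.arccos (R i i))) +
    (R - Matrix.diagonal R.diag) *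
      Matrix.diagonal fun i => Real.sin (t * Real.arccos (R i i)) / Real.sin (Real.arccos (R i i))

/-- The velocity of `rotationCurve`. -/
noncomputable def rotationVelocity (R : Mat p) (t : ℝ) : Mat p :=
  Matrix.diagonal (fun i => -(Real.arccos (R i i) * Real.sin (t * Real.arccos (R i i)))) +
    (R - Matrix.diagonal R.diag) *
      Matrix.diagonal fun i => Real.arccos (R i i) * Real.cos (t * Real.arccos (R i i)) /
        Real.sin (Real.arccos (R i i))

theorem rotationCurve_apply_self (R : Mat p) (t : ℝ) (i : Fin p) :
    rotationCurve R t i i = Real.cos (t * Real.arccos (R i i)) := by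
  simp [rotationCurve, Matrix.mul_diagonal]

theorem rotationCurve_zero (R : Mat p) : rotationCurve R 0 = 1 := by
  simp [rotationCurve]

theorem arccos_eq_zero_or_sin_pos {x : ℝ} (hx : -1 < x) :
    Real.arccos x = 0 ∨ 0 < Real.sin (Real.arccos x) := by
  rcases (Real.arccos_nonneg x).eq_or_lt with h | h
  · exact Or.inl h.symm
  · refine Or.inr (Real.sin_pos_of_pos_of_lt_pi h ((Real.arccos_le_pi x).lt_of_ne ?_))
    rw [Ne, Real.arccos_eq_pi]
    exact hx.not_ge

theorem one_sub_sq_diag (hR : R ∈ SO p) (i : Fin p) :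
    1 - R i i ^ 2 = Real.sin (Real.arccos (R i i)) ^ 2 := by
  have h := diag_mem_Icc_of_mem_SO hR i
  have := Real.sin_sq_add_cos_sq (Real.arccos (R i i))
  rw [Real.cos_arccos h.1 h.2] at this
  linarith

theorem rotationCurve_one (hR : R ∈ SO p) (hoff : ∀ i j, i ≠ j → R i j = -R j i)
    (hR1 : ∀ i, -1 < R i i) : rotationCurve R 1 = R := by
  obtain ⟨-, hK, -⟩ := skew_part_identities hR hoff
  ext i j
  have hd := diag_mem_Icc_of_mem_SO hR
  by_cases hij : i = j
  · subst hij
    rw [rotationCurve_apply_self, one_mul, Real.cos_arccos (hd i).1 (hd i).2]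
  · rw [rotationCurve, Matrix.add_apply, Matrix.diagonal_apply_ne _ hij, Matrix.mul_diagonal,
      Matrix.sub_apply, Matrix.diagonal_apply_ne _ hij, one_mul, zero_add, sub_zero]
    rcases arccos_eq_zero_or_sin_pos (hR1 j) with h | h
    · have h1 : R j j = 1 := by
        rw [Real.arccos_eq_zero] at h; exact le_antisymm (hd j).2 h
      have h2 := Finset.add_le_sum (f := fun r => R r j ^ 2) (fun r _ => sq_nonneg _)
        (Finset.mem_univ i) (Finset.mem_univ j) hij
      rw [sum_sq_col_of_mem_SO hR, h1] at h2
      have h3 : R i j = 0 := by nlinarith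
      rw [h3, zero_mul]
    · rw [div_self h.ne', mul_one]

theorem rotationCurve_transpose_mul_self (hR : R ∈ SO p)
    (hoff : ∀ i j, i ≠ j → R i j = -R j i) (hR1 : ∀ i, -1 < R i i) (t : ℝ) :
    (rotationCurve R t)ᵀ * rotationCurve R t = 1 := by
  have h := transpose_mul_self_diagonal_add hR hoff (fun x => Real.cos (t * Real.arccos x))
    fun x => Real.sin (t * Real.arccos x) / Real.sin (Real.arccos x)
  rw [rotationCurve, h, ← Matrix.diagonal_one]
  congr 1
  funext i
  rw [one_sub_sq_diag hR]
  rcases arccos_eq_zero_or_sin_pos (hR1 i) with h | h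
  · simp [h]
  · rw [div_pow, div_mul_cancel₀ _ (by positivity), Real.cos_sq_add_sin_sq]

theorem sum_sq_rotationVelocity (hR : R ∈ SO p)
    (hoff : ∀ i j, i ≠ j → R i j = -R j i) (hR1 : ∀ i, -1 < R i i) (t : ℝ) :
    ∑ i, ∑ j, rotationVelocity R t i j ^ 2 = ∑ i, Real.arccos (R i i) ^ 2 := by
  have h := transpose_mul_self_diagonal_add hR hoff
    (fun x => -(Real.arccos x * Real.sin (t * Real.arccos x)))
    fun x => Real.arccos x * Real.cos (t * Real.arccos x) / Real.sin (Real.arccos x)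
  rw [← trace_transpose_mul_self, rotationVelocity, h, Matrix.trace_diagonal]
  refine Finset.sum_congr rfl fun i _ => ?_
  rw [one_sub_sq_diag hR]
  rcases arccos_eq_zero_or_sin_pos (hR1 i) with h | h
  · simp [h]
  · rw [div_pow, div_mul_cancel₀ _ (by positivity)]
    linear_combination Real.arccos (R i i) ^ 2 * Real.sin_sq_add_cos_sq (t * Real.arccos (R i i))

theorem hasDerivAt_diagonal {f : ℝ → Fin p → ℝ} {f' : Fin p → ℝ} {t : ℝ}
    (h : ∀ i, HasDerivAt (fun t => f t i) (f' i) t) :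
    HasDerivAt (fun t => (Matrix.diagonal (f t) : Mat p)) (Matrix.diagonal f') t :=
  (LinearMap.toContinuousLinearMap
    (Matrix.diagonalLinearMap (Fin p) ℝ ℝ)).hasFDerivAt.comp_hasDerivAt t (hasDerivAt_pi.2 h)

theorem contDiff_diagonal {f : ℝ → Fin p → ℝ} (h : ∀ i, ContDiff ℝ ∞ fun t => f t i) :
    ContDiff ℝ ∞ fun t => (Matrix.diagonal (f t) : Mat p) :=
  (LinearMap.toContinuousLinearMap
    (Matrix.diagonalLinearMap (Fin p) ℝ ℝ)).contDiff.comp (contDiff_pi.2 h)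

theorem hasDerivAt_rotationCurve (R : Mat p) (t : ℝ) :
    HasDerivAt (rotationCurve R) (rotationVelocity R t) t := by
  have h : ∀ θ : ℝ, HasDerivAt (fun t : ℝ => t * θ) θ t := fun θ => by
    simpa using (hasDerivAt_id t).mul_const θ
  refine HasDerivAt.add (hasDerivAt_diagonal fun i => ?_)
    (HasDerivAt.const_mul _ (hasDerivAt_diagonal fun i => ?_))
  · exact (h (Real.arccos (R i i))).cos.congr_deriv (by ring)
  · exact ((h (Real.arccos (R i i))).sin.div_const _).congr_deriv (by ring)

theorem contDiff_rotationCurve (R : Mat p) : ContDiff ℝ ∞ (rotationCurve R) := by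
  refine ContDiff.add (contDiff_diagonal fun i => ?_)
    (ContDiff.mul contDiff_const (contDiff_diagonal fun i => ?_))
  · exact Real.contDiff_cos.comp (contDiff_id.mul contDiff_const)
  · exact (Real.contDiff_sin.comp (contDiff_id.mul contDiff_const)).div_const _

theorem rotationCurve_mem_SO (hR : R ∈ SO p)
    (hoff : ∀ i j, i ≠ j → R i j = -R j i) (hR1 : ∀ i, -1 < R i i) (t : ℝ) :
    rotationCurve R t ∈ SO p := by
  have horth := rotationCurve_transpose_mul_self hR hoff hR1
  refine mem_SO_of (horth t) ?_
  have hsq : ∀ t, (rotationCurve R t).det ^ 2 = 1 := fun t => by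
    have := congrArg Matrix.det (horth t)
    rwa [Matrix.det_mul, Matrix.det_transpose, Matrix.det_one, ← sq] at this
  have hcont : Continuous fun t => (rotationCurve R t).det :=
    (contDiff_rotationCurve R).continuous.matrix_det
  -- The determinant is `1` at `t = 0`, squares to `1`, and is continuous in `t`.
  by_contra hne
  have hneg : (rotationCurve R t).det = -1 :=
    (eq_or_eq_neg_of_sq_eq_sq _ 1 (by rw [hsq t, one_pow])).resolve_left hne
  obtain ⟨u, hu⟩ := mem_range_of_exists_le_of_exists_ge hcont (c := 0)
    ⟨t, by rw [hneg]; norm_num⟩ ⟨0, by rw [rotationCurve_zero, Matrix.det_one]; norm_num⟩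
  have := hsq u
  simp only at hu
  rw [hu] at this
  norm_num at this

end Rotation

/-- The geodesic in `M(p)` from `a` to `b` that is given by a basis adapted to `a.1ᵀ * b.1`. -/
noncomputable def connectingCurve (Q : Mat p) (a b : Mat p × Mat p) (t : ℝ) : Mat p × Mat p :=
  (a.1 * Q * rotationCurve (Qᵀ * (a.1ᵀ * b.1) * Q) t * Qᵀ,
    Matrix.diagonal fun j =>
      a.2 j j * Real.exp (t * (Real.log (b.2 j j) - Real.log (a.2 j j))))

theorem transpose_mul_mem_SO {U V : Mat p} (hU : U ∈ SO p) (hV : V ∈ SO p) : Uᵀ * V ∈ SO p := by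
  refine mem_SO_of ?_ ?_
  · rw [Matrix.transpose_mul, Matrix.transpose_transpose, Matrix.mul_assoc, ← Matrix.mul_assoc U,
      mul_transpose_self_of_mem_SO hU, Matrix.one_mul, transpose_mul_self_of_mem_SO hV]
  · rw [Matrix.det_mul, Matrix.det_transpose, det_of_mem_SO hU, det_of_mem_SO hV, one_mul]

theorem mul_mem_SO {U V : Mat p} (hU : U ∈ SO p) (hV : V ∈ SO p) : U * V ∈ SO p :=
  (Matrix.specialOrthogonalGroup (Fin p) ℝ).mul_mem hU hV

section Connecting

variable {Q : Mat p} {a b : Mat p × Mat p}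

theorem contDiff_connectingCurve (Q : Mat p) (a b : Mat p × Mat p) :
    ContDiff ℝ ∞ (connectingCurve Q a b) := by
  refine ContDiff.prodMk ?_ (contDiff_diagonal fun j => ?_)
  · exact (contDiff_const.mul (contDiff_rotationCurve _)).mul contDiff_const
  · exact contDiff_const.mul (Real.contDiff_exp.comp (contDiff_id.mul contDiff_const))

theorem connectingCurve_zero (hQ : Qᵀ * Q = 1) (ha : a ∈ M p) : connectingCurve Q a b 0 = a := by
  refine Prod.ext ?_ ?_
  · rw [connectingCurve, rotationCurve_zero, Matrix.mul_one, Matrix.mul_assoc,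
      mul_eq_one_comm.1 hQ, Matrix.mul_one]
  · refine Eq.trans ?_ ha.2.1.diagonal_diag
    simp only [connectingCurve, zero_mul, Real.exp_zero, mul_one]
    rfl

/-- The columns of `Q` form a basis adapted to `a.1ᵀ * b.1`, and no rotation angle from `a.1` to
`b.1` equals `π`. -/
structure IsNonantipodalBasis (Q : Mat p) (a b : Mat p × Mat p) : Prop where
  isAdapted : IsAdapted (a.1ᵀ * b.1) Q
  left_mem : a ∈ M p
  right_mem : b ∈ M p
  angle_lt_pi : ∀ i, angle (column Q a.1 i) (column Q b.1 i) < Real.pi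

theorem IsNonantipodalBasis.neg_one_lt (h : IsNonantipodalBasis Q a b) (i : Fin p) :
    -1 < (Qᵀ * (a.1ᵀ * b.1) * Q) i i := by
  have hi := h.angle_lt_pi i
  rw [angle_column h.isAdapted.1 h.left_mem.1 h.right_mem.1] at hi
  by_contra! hle
  exact hi.ne (Real.arccos_eq_pi.2 hle)

theorem connectingCurve_one (h : IsNonantipodalBasis Q a b) : connectingCurve Q a b 1 = b := by
  have hR := conj_mem_SO (transpose_mul_mem_SO h.left_mem.1 h.right_mem.1) h.isAdapted.1
  have hQ' := mul_eq_one_comm.1 h.isAdapted.1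
  refine Prod.ext ?_ ?_
  · rw [connectingCurve, rotationCurve_one hR h.isAdapted.2 (h.neg_one_lt)]
    calc a.1 * Q * (Qᵀ * (a.1ᵀ * b.1) * Q) * Qᵀ = a.1 * ((Q * Qᵀ) * (a.1ᵀ * b.1) * (Q * Qᵀ)) := by
          simp only [Matrix.mul_assoc]
      _ = b.1 := by
          rw [hQ', Matrix.one_mul, Matrix.mul_one, ← Matrix.mul_assoc,
            mul_transpose_self_of_mem_SO h.left_mem.1, Matrix.one_mul]
  · refine Eq.trans ?_ h.right_mem.2.1.diagonal_diag
    refine congrArg Matrix.diagonal (funext fun j => ?_)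
    have h1 := h.left_mem.2.2 j
    have h2 := h.right_mem.2.2 j
    rw [Matrix.diag_apply, one_mul, Real.exp_sub, Real.exp_log h1, Real.exp_log h2,
      mul_div_cancel₀ _ h1.ne']

theorem connectingCurve_mem (h : IsNonantipodalBasis Q a b) (t : ℝ) :
    connectingCurve Q a b t ∈ M p := by
  have hR := conj_mem_SO (transpose_mul_mem_SO h.left_mem.1 h.right_mem.1) h.isAdapted.1
  have hrot := rotationCurve_mem_SO hR h.isAdapted.2 (h.neg_one_lt) t
  have hQt : Qᵀᵀ * Qᵀ = 1 := by
    rw [Matrix.transpose_transpose]; exact mul_eq_one_comm.1 h.isAdapted.1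
  refine ⟨?_, Matrix.isDiag_diagonal _, fun j => ?_⟩
  · have := mul_mem_SO h.left_mem.1 (conj_mem_SO hrot hQt)
    rwa [Matrix.transpose_transpose, ← Matrix.mul_assoc, ← Matrix.mul_assoc] at this
  · simp only [connectingCurve, Matrix.diagonal_apply_eq]
    exact mul_pos (h.left_mem.2.2 j) (Real.exp_pos _)

theorem isCurveIn_connectingCurve (h : IsNonantipodalBasis Q a b) (x y : ℝ) :
    IsCurveIn (M p) (connectingCurve Q a b) x y :=
  ⟨⟨(contDiff_connectingCurve Q a b).continuous.continuousOn, ∅, fun _ _ _ _ _ _ =>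
    (contDiff_connectingCurve Q a b).contDiffOn⟩, fun t _ => connectingCurve_mem h t⟩

theorem speed_connectingCurve (h : IsNonantipodalBasis Q a b) {k : ℝ} (hk : 0 ≤ k) (t : ℝ) :
    metricM k (connectingCurve Q a b t) (deriv (connectingCurve Q a b) t)
      (deriv (connectingCurve Q a b) t) = ‖gap k Q a b‖ ^ 2 := by
  have hR := conj_mem_SO (transpose_mul_mem_SO h.left_mem.1 h.right_mem.1) h.isAdapted.1
  have hR1 := h.neg_one_lt
  set R := Qᵀ * (a.1ᵀ * b.1) * Q with hRdef
  have hd1 : HasDerivAt (fun t => (connectingCurve Q a b t).1)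
      (a.1 * Q * rotationVelocity R t * Qᵀ) t :=
    ((hasDerivAt_rotationCurve R t).const_mul _).mul_const _
  have hd2 : HasDerivAt (fun t => (connectingCurve Q a b t).2)
      (Matrix.diagonal fun j => a.2 j j *
        (Real.exp (t * (Real.log (b.2 j j) - Real.log (a.2 j j))) *
          (1 * (Real.log (b.2 j j) - Real.log (a.2 j j))))) t :=
    hasDerivAt_diagonal fun j => (((hasDerivAt_id t).mul_const _).exp).const_mul _
  have hd : HasDerivAt (connectingCurve Q a b) (_, _) t := hd1.prodMk hd2
  have hd' : deriv (connectingCurve Q a b) t = (_, _) := hd.deriv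
  have := metricM_self (k := k) hd.hasDerivWithinAt uniqueDiffWithinAt_univ (Set.mem_univ t)
    fun z _ => connectingCurve_mem h z
  rw [hd', this, norm_gap_sq hk]
  congr 1
  · congr 1
    simp only [angle_column h.isAdapted.1 h.left_mem.1 h.right_mem.1]
    rw [← sum_sq_rotationVelocity hR h.isAdapted.2 hR1 t, ← trace_transpose_mul_self,
      ← trace_transpose_mul_self]
    set W := rotationVelocity R t
    calc ((a.1 * Q * W * Qᵀ)ᵀ * (a.1 * Q * W * Qᵀ)).trace
        = (Q * (Wᵀ * (Qᵀ * (a.1ᵀ * a.1) * Q) * W * Qᵀ)).trace := by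
          simp only [Matrix.transpose_mul, Matrix.transpose_transpose, Matrix.mul_assoc]
      _ = (Wᵀ * W).trace := by
          rw [transpose_mul_self_of_mem_SO h.left_mem.1, Matrix.mul_one, h.isAdapted.1,
            Matrix.mul_one, Matrix.trace_mul_comm, Matrix.mul_assoc, h.isAdapted.1,
            Matrix.mul_one]
  · refine Finset.sum_congr rfl fun j _ => ?_
    have h1 := (h.left_mem.2.2 j).ne'
    have h2 := (Real.exp_pos (t * (Real.log (b.2 j j) - Real.log (a.2 j j)))).ne'
    simp only [connectingCurve, Matrix.diagonal_apply_eq]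
    congr 1
    field_simp

theorem curveLength_connectingCurve (h : IsNonantipodalBasis Q a b) {k : ℝ} (hk : 0 ≤ k)
    (x y : ℝ) :
    curveLength (metricM k) (connectingCurve Q a b) x y = ‖gap k Q a b‖ * (y - x) := by
  have : ∀ t, √(metricM k (connectingCurve Q a b t) (deriv (connectingCurve Q a b) t)
      (deriv (connectingCurve Q a b) t)) = ‖gap k Q a b‖ := fun t => by
    rw [speed_connectingCurve h hk, Real.sqrt_sq (norm_nonneg _)]
  refine (intervalIntegral.integral_congr fun t _ => this t).trans ?_
  rw [intervalIntegral.integral_const, smul_eq_mul, mul_comm]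

theorem hasConstantSpeed_connectingCurve (h : IsNonantipodalBasis Q a b) {k : ℝ} (hk : 0 ≤ k)
    (x y : ℝ) :
    HasConstantSpeed (metricM k) (connectingCurve Q a b) x y :=
  ⟨_, fun s t _ _ _ => curveLength_connectingCurve h hk s t⟩

/-- The explicit geodesic realizes the distance in the product of spheres and lines as long as no
column passes its antipode. -/
theorem gap_connectingCurve (h : IsNonantipodalBasis Q a b) (k : ℝ) {t : ℝ} (ht : 0 ≤ t)
    (htpi : ∀ i, t * angle (column Q a.1 i) (column Q b.1 i) ≤ Real.pi) :
    gap k Q a (connectingCurve Q a b t) = t • gap k Q a b := by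
  have hE := connectingCurve_mem h t
  ext i
  rw [PiLp.smul_apply, smul_eq_mul]
  rcases i with i | j
  · rw [gap_inl, gap_inl, mul_left_comm]
    congr 1
    have hi := htpi i
    rw [angle_column h.isAdapted.1 h.left_mem.1 h.right_mem.1] at hi ⊢
    rw [angle_column h.isAdapted.1 h.left_mem.1 hE.1]
    have : Qᵀ * (a.1ᵀ * (connectingCurve Q a b t).1) * Q =
        rotationCurve (Qᵀ * (a.1ᵀ * b.1) * Q) t := by
      rw [connectingCurve]
      set W := rotationCurve (Qᵀ * (a.1ᵀ * b.1) * Q) t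
      calc Qᵀ * (a.1ᵀ * (a.1 * Q * W * Qᵀ)) * Q
          = Qᵀ * (a.1ᵀ * a.1) * Q * W * (Qᵀ * Q) := by simp only [Matrix.mul_assoc]
        _ = W := by
          rw [transpose_mul_self_of_mem_SO h.left_mem.1, Matrix.mul_one, h.isAdapted.1, Matrix.one_mul,
            Matrix.mul_one]
    rw [this, rotationCurve_apply_self,
      Real.arccos_cos (mul_nonneg ht (Real.arccos_nonneg _)) hi]
  · rw [gap_inr, gap_inr, connectingCurve]
    simp only [Matrix.diagonal_apply_eq]
    rw [Real.log_mul (h.left_mem.2.2 j).ne' (Real.exp_pos _).ne', Real.log_exp, add_sub_cancel_left,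
      abs_mul, abs_of_nonneg ht]

theorem riemannianDist_le_norm_gap (h : IsNonantipodalBasis Q a b) {k : ℝ} (hk : 0 ≤ k) :
    riemannianDist (M p) (metricM k) a b ≤ ‖gap k Q a b‖ := by
  refine csInf_le ⟨0, ?_⟩ ⟨connectingCurve Q a b, isCurveIn_connectingCurve h 0 1,
    connectingCurve_zero h.isAdapted.1 h.left_mem, connectingCurve_one h, ?_⟩
  · rintro _ ⟨c, -, -, -, rfl⟩
    exact curveLength_nonneg _ _ zero_le_one
  · rw [curveLength_connectingCurve h hk, sub_zero, mul_one]

end Connecting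

/-! ### The cut locus in `SO(p)` -/

theorem one_mem_DiagPos : (1 : Mat p) ∈ DiagPos p :=
  ⟨Matrix.isDiag_one, fun i => by simp⟩

theorem deriv_prodMk_one (c : ℝ → Mat p) (t : ℝ) :
    deriv (fun t => (c t, (1 : Mat p))) t = (deriv c t, 0) := by
  by_cases h : DifferentiableAt ℝ c t
  · exact (h.hasDerivAt.prodMk (hasDerivAt_const t (1 : Mat p))).deriv
  · exact (deriv_zero_of_not_differentiableAt fun h' => h h'.fst).trans
      (congrArg (·, (0 : Mat p)) (deriv_zero_of_not_differentiableAt h).symm)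

/-- `SO(p)` embeds isometrically into `M(p)` for the weight `1`. -/
theorem curveLength_prodMk_one (c : ℝ → Mat p) (x y : ℝ) :
    curveLength (metricM 1) (fun t => (c t, (1 : Mat p))) x y = curveLength soMetric c x y := by
  refine intervalIntegral.integral_congr fun t _ => congrArg Real.sqrt ?_
  have h : metricM 1 (c t, (1 : Mat p)) (deriv c t, 0) (deriv c t, 0) =
      soMetric (c t) (deriv c t) (deriv c t) := by simp [metricM, diagMetric]
  exact (congrArg (fun v => metricM 1 (c t, (1 : Mat p)) v v) (deriv_prodMk_one c t)).trans h

theorem isCurveIn_prodMk_one {c : ℝ → Mat p} {x y : ℝ} (h : IsCurveIn (SO p) c x y) :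
    IsCurveIn (M p) (fun t => (c t, (1 : Mat p))) x y := by
  obtain ⟨⟨hc, B, hB⟩, hm⟩ := h
  exact ⟨⟨hc.prodMk continuousOn_const, B, fun u v h1 h2 h3 h4 =>
    (hB u v h1 h2 h3 h4).prodMk contDiffOn_const⟩, fun t ht => ⟨hm t ht, one_mem_DiagPos⟩⟩

theorem IsNonantipodalBasis.symm {Q : Mat p} {a b : Mat p × Mat p}
    (h : IsNonantipodalBasis Q a b) : IsNonantipodalBasis Q b a where
  isAdapted := by
    refine ⟨h.isAdapted.1, fun i j hij => ?_⟩
    have ht : Qᵀ * (b.1ᵀ * a.1) * Q = (Qᵀ * (a.1ᵀ * b.1) * Q)ᵀ := by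
      simp only [Matrix.transpose_mul, Matrix.transpose_transpose, Matrix.mul_assoc]
    rw [ht, Matrix.transpose_apply, Matrix.transpose_apply]
    exact h.isAdapted.2 j i hij.symm
  left_mem := h.right_mem
  right_mem := h.left_mem
  angle_lt_pi i := by rw [angle_comm]; exact h.angle_lt_pi i

theorem IsNonantipodalBasis.prodMk_one {Q : Mat p} {a b : Mat p × Mat p}
    (h : IsNonantipodalBasis Q a b) : IsNonantipodalBasis Q (a.1, 1) (b.1, 1) where
  isAdapted := h.isAdapted
  left_mem := ⟨h.left_mem.1, one_mem_DiagPos⟩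
  right_mem := ⟨h.right_mem.1, one_mem_DiagPos⟩
  angle_lt_pi := h.angle_lt_pi

/-- The lengths of curves in `SO(p)` are bounded below by the distance in the product of spheres. -/
theorem norm_gap_le_curveLength_soMetric {Q : Mat p} (hQ : Qᵀ * Q = 1) {c : ℝ → Mat p}
    (hc : IsCurveIn (SO p) c 0 1) :
    ‖gap 1 Q (c 0, 1) (c 1, 1)‖ ≤ curveLength soMetric c 0 1 := by
  rw [← curveLength_prodMk_one]
  exact norm_gap_le_curveLength zero_le_one hQ (isCurveIn_prodMk_one hc) le_rfl zero_le_one le_rfl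

theorem riemannianDist_le_curveLength {E : Type*} [NormedAddCommGroup E] [NormedSpace ℝ E]
    {S : Set E} (g : E → E → E → ℝ) {c : ℝ → E} (hc : IsCurveIn S c 0 1) :
    riemannianDist S g (c 0) (c 1) ≤ curveLength g c 0 1 := by
  refine csInf_le ⟨0, ?_⟩ ⟨c, hc, rfl, rfl, rfl⟩
  rintro _ ⟨c', -, -, -, rfl⟩
  exact curveLength_nonneg _ _ zero_le_one

theorem curveLength_soMetric_comp_mul {c : ℝ → Mat p} {s : ℝ} (hs : 0 < s) :
    curveLength soMetric (fun t => c (s * t)) 0 1 = curveLength soMetric c 0 s := by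
  have h : ∀ t, √(soMetric (c (s * t)) (deriv (fun t => c (s * t)) t)
      (deriv (fun t => c (s * t)) t)) =
      s * √(soMetric (c (s * t)) (deriv c (s * t)) (deriv c (s * t))) := by
    intro t
    have hd : deriv (fun t => c (s * t)) t = s • deriv c (s * t) := deriv_comp_mul_left s c t
    have h2 : soMetric (c (s * t)) (s • deriv c (s * t)) (s • deriv c (s * t)) =
        s ^ 2 * soMetric (c (s * t)) (deriv c (s * t)) (deriv c (s * t)) := by
      simp only [soMetric, Matrix.mul_smul, Matrix.smul_mul, Matrix.trace_smul, smul_eq_mul]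
      ring
    refine (congrArg (fun v => √(soMetric (c (s * t)) v v)) hd).trans ?_
    rw [h2, Real.sqrt_mul (sq_nonneg s), Real.sqrt_sq hs.le]
  refine (intervalIntegral.integral_congr fun t _ => h t).trans ?_
  rw [intervalIntegral.integral_const_mul]
  have := intervalIntegral.integral_comp_mul_left (a := 0) (b := 1)
    (fun t => √(soMetric (c t) (deriv c t) (deriv c t))) hs.ne'
  rw [mul_zero, mul_one, smul_eq_mul] at this
  refine (congrArg (s * ·) this).trans ?_
  exact mul_inv_cancel_left₀ hs.ne' _

/-- If no rotation angle from `U` to `V` equals `π`, then `V` is not in the cut locus of `U`: the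
unique minimal geodesic from `U` to `V` remains minimal beyond `V`. -/
theorem IsNonantipodalBasis.notMem_cutLocus {Q U V : Mat p}
    (h : IsNonantipodalBasis Q (U, 1) (V, 1)) : V ∉ cutLocus (SO p) soMetric U := by
  rintro ⟨c, ⟨hc, hs, hlen⟩, rfl, rfl, hne⟩
  apply hne
  set a : Mat p × Mat p := (c 0, 1) with ha
  set b : Mat p × Mat p := (c 1, 1) with hb
  set E := connectingCurve Q a b with hEdef
  have hE2 : ∀ t, (E t).2 = 1 := fun t => by simp [hEdef, connectingCurve, ha, hb]
  have hEpair : (fun t => ((E t).1, (1 : Mat p))) = E := by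
    funext t; exact Prod.ext rfl (hE2 t).symm
  have hE0 : E 0 = a := connectingCurve_zero h.isAdapted.1 h.left_mem
  have hE1 : E 1 = b := connectingCurve_one h
  have hElen : ∀ x y, curveLength soMetric (fun t => (E t).1) x y = ‖gap 1 Q a b‖ * (y - x) := by
    intro x y
    rw [← curveLength_prodMk_one, hEpair]
    exact curveLength_connectingCurve h zero_le_one x y
  have hEsmooth : ContDiff ℝ ∞ fun t => (E t).1 := (contDiff_connectingCurve Q a b).fst
  have hEcurve : ∀ r x y, IsCurveIn (SO p) (fun t => (E (r * t)).1) x y := fun r x y =>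
    have hsm : ContDiff ℝ ∞ fun t => (E (r * t)).1 :=
      hEsmooth.comp (contDiff_const.mul contDiff_id)
    ⟨⟨hsm.continuous.continuousOn, ∅, fun _ _ _ _ _ _ => hsm.contDiffOn⟩,
      fun t _ => (connectingCurve_mem h (r * t)).1⟩
  have hEcurve1 : ∀ x y, IsCurveIn (SO p) (fun t => (E t).1) x y := by
    simpa only [one_mul] using hEcurve 1
  -- The given minimal geodesic agrees with the explicit one.
  have hclen : curveLength (metricM 1) (fun t => (c t, (1 : Mat p))) 0 1 ≤ ‖gap 1 Q a b‖ := by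
    have := riemannianDist_le_curveLength soMetric (hEcurve1 0 1)
    rw [hE0, hE1, hElen, sub_zero, mul_one] at this
    rw [curveLength_prodMk_one, hlen]
    exact this
  have heq : Set.EqOn (fun t => (c t, (1 : Mat p))) E (Set.Icc 0 1) := by
    refine eqOn_of_curveLength_le one_pos h.isAdapted.1 h.angle_lt_pi (isCurveIn_prodMk_one hc) ?_
      rfl rfl hclen (isCurveIn_connectingCurve h 0 1)
      (hasConstantSpeed_connectingCurve h zero_le_one 0 1) hE0 hE1 ?_
    · obtain ⟨v, hv⟩ := hs
      refine ⟨v, fun x y h1 h2 h3 => ?_⟩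
      rw [curveLength_prodMk_one]
      exact hv x y h1 h2 h3
    · rw [curveLength_connectingCurve h zero_le_one, sub_zero, mul_one]
  obtain ⟨s, hs1, hspi⟩ : ∃ s : ℝ, 1 < s ∧
      ∀ i, s * angle (column Q a.1 i) (column Q b.1 i) < Real.pi := by
    have hev : ∀ᶠ s in 𝓝[>] (1 : ℝ), ∀ i,
        s * angle (column Q a.1 i) (column Q b.1 i) < Real.pi := by
      refine eventually_all.2 fun i => ?_
      have ht : Tendsto (fun s : ℝ => s * angle (column Q a.1 i) (column Q b.1 i)) (𝓝[>] 1)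
          (𝓝 (1 * angle (column Q a.1 i) (column Q b.1 i))) :=
        ((continuous_id.mul continuous_const).tendsto 1).mono_left nhdsWithin_le_nhds
      rw [one_mul] at ht
      exact ht.eventually_lt_const (h.angle_lt_pi i)
    obtain ⟨s, h1, h2⟩ := (hev.and self_mem_nhdsWithin).exists
    exact ⟨s, h2, h1⟩
  have hs0 : 0 < s := zero_lt_one.trans hs1
  refine ⟨s, hs1, fun t => (E t).1, ⟨hEcurve1 0 s, ⟨_, fun x y _ _ _ => hElen x y⟩, ?_⟩,
    fun t ht => congrArg Prod.fst (heq ht)⟩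
  have hresc : curveLength soMetric (fun t => (E (s * t)).1) 0 1 = ‖gap 1 Q a b‖ * (s - 0) := by
    rw [← hElen]
    exact curveLength_soMetric_comp_mul (c := fun t => (E t).1) hs0
  rw [hElen]
  refine le_antisymm ?_ ?_
  · refine le_csInf ⟨_, fun t => (E (s * t)).1, hEcurve s 0 1, by simp, by simp, rfl⟩ ?_
    rintro _ ⟨d, hd, hd0, hd1, rfl⟩
    refine le_trans ?_ (norm_gap_le_curveLength_soMetric h.isAdapted.1 hd)
    have e1 : (d 0, (1 : Mat p)) = a := by
      have h0 := congrArg Prod.fst hE0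
      rw [hd0]
      exact Prod.ext h0 rfl
    have e2 : (d 1, (1 : Mat p)) = E s := by rw [hd1]; exact Prod.ext rfl (hE2 s).symm
    rw [e1, e2, gap_connectingCurve h 1 hs0.le fun i => (hspi i).le, norm_smul,
      Real.norm_of_nonneg hs0.le, sub_zero, mul_comm]
  · have := riemannianDist_le_curveLength soMetric (hEcurve s 0 1)
    simp only [mul_zero, mul_one] at this
    rw [hresc] at this
    exact this

/-! ### Shortening by sign changes -/

/-- Jordan's inequality for half of the angle `arccos x`. It is an equality only for the angles `0`
and `π`. -/
theorem arccos_sq_le {x : ℝ} (h1 : -1 ≤ x) (h2 : x ≤ 1) :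
    Real.arccos x ^ 2 ≤ Real.pi ^ 2 / 2 * (1 - x) ∧
      (-1 < x → x < 1 → Real.arccos x ^ 2 < Real.pi ^ 2 / 2 * (1 - x)) := by
  have hpi := Real.pi_pos
  have h0 := Real.arccos_nonneg x
  have hle := Real.arccos_le_pi x
  set θ := Real.arccos x
  have hx : 1 - x = 2 * Real.sin (θ / 2) ^ 2 := by
    have := Real.cos_two_mul (θ / 2)
    rw [mul_div_cancel₀ _ two_ne_zero, Real.cos_arccos h1 h2] at this
    rw [this, Real.sin_sq]; ring
  have hrew : Real.pi ^ 2 / 2 * (1 - x) = (Real.pi * Real.sin (θ / 2)) ^ 2 := by rw [hx]; ring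
  have hθ : θ = Real.pi * (2 / Real.pi * (θ / 2)) := by field_simp
  rw [hrew]
  constructor
  · refine pow_le_pow_left₀ h0 ?_ 2
    have := mul_le_mul_of_nonneg_left (Real.mul_le_sin (x := θ / 2) (by linarith) (by linarith))
      hpi.le
    rwa [← hθ] at this
  · intro h3 h4
    have hpos : 0 < θ := Real.arccos_pos.2 h4
    have hlt : θ < Real.pi := hle.lt_of_ne fun h => h3.not_ge (Real.arccos_eq_pi.1 h)
    refine pow_lt_pow_left₀ ?_ h0 two_ne_zero
    have := mul_lt_mul_of_pos_left (Real.mul_lt_sin (x := θ / 2) (by linarith) (by linarith)) hpi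
    rwa [← hθ] at this

theorem trace_conj {Q : Mat p} (hQ : Qᵀ * Q = 1) (R : Mat p) : (Qᵀ * R * Q).trace = R.trace := by
  rw [Matrix.trace_mul_comm, ← Matrix.mul_assoc, mul_eq_one_comm.1 hQ, Matrix.one_mul]

theorem isSymm_of_sq_diag_eq_one {R Q : Mat p} (hR : R ∈ SO p) (hQ : Qᵀ * Q = 1)
    (h : ∀ i, (Qᵀ * R * Q) i i ^ 2 = 1) : R.IsSymm := by
  have hR' := conj_mem_SO hR hQ
  have hsymm : (Qᵀ * R * Q)ᵀ = Qᵀ * R * Q := by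
    have hz : ∀ i j, i ≠ j → (Qᵀ * R * Q) i j = 0 := by
      intro i j hij
      have h1 := Finset.add_le_sum (f := fun r => (Qᵀ * R * Q) r j ^ 2) (fun r _ => sq_nonneg _)
        (Finset.mem_univ i) (Finset.mem_univ j) hij
      rw [sum_sq_col_of_mem_SO hR', h j] at h1
      nlinarith
    ext i j
    rw [Matrix.transpose_apply]
    by_cases hij : i = j
    · rw [hij]
    · rw [hz i j hij, hz j i (Ne.symm hij)]
  have hQ' := mul_eq_one_comm.1 hQ
  have hback : R = Q * (Qᵀ * R * Q) * Qᵀ := by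
    calc R = (Q * Qᵀ) * R * (Q * Qᵀ) := by rw [hQ', Matrix.one_mul, Matrix.mul_one]
      _ = _ := by simp only [Matrix.mul_assoc]
  rw [Matrix.IsSymm, hback, Matrix.transpose_mul, Matrix.transpose_mul, hsymm,
    Matrix.transpose_transpose]
  simp only [Matrix.mul_assoc]

/-- A rotation whose trace exceeds `p - 4` is at distance less than `π` from the identity, and has no
rotation angle `π`. The same holds for a nonsymmetric rotation with trace `p - 4`. -/
theorem sum_angle_sq_lt {Q : Mat p} {a b : Mat p × Mat p} (ha : a ∈ M p) (hb : b ∈ M p)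
    (hQ : IsAdapted (a.1ᵀ * b.1) Q) (htr : (p : ℝ) - 4 ≤ (a.1ᵀ * b.1).trace)
    (hstrict : (p : ℝ) - 4 < (a.1ᵀ * b.1).trace ∨ ¬ (a.1ᵀ * b.1).IsSymm) :
    IsNonantipodalBasis Q a b ∧
      ∑ i, angle (column Q a.1 i) (column Q b.1 i) ^ 2 < 2 * Real.pi ^ 2 := by
  have hR := transpose_mul_mem_SO ha.1 hb.1
  have hR' := conj_mem_SO hR hQ.1
  rw [← trace_conj hQ.1] at htr hstrict
  have hsymm := isSymm_of_sq_diag_eq_one hR hQ.1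
  have hang := angle_column hQ.1 ha.1 hb.1
  obtain ⟨hQ1, hoff⟩ := id hQ
  set R := Qᵀ * (a.1ᵀ * b.1) * Q
  have hd := diag_mem_Icc_of_mem_SO hR'
  have hsum : ∑ i, (1 - R i i) = p - R.trace := by
    rw [Finset.sum_sub_distrib]; simp [Matrix.trace]
  have hnn : ∀ i ∈ Finset.univ, 0 ≤ 1 - R i i := fun i _ => sub_nonneg.2 (hd i).2
  have hlt : ∀ i, -1 < R i i := by
    intro i
    refine (hd i).1.lt_of_ne fun hi => ?_
    obtain ⟨j, hji, hj⟩ := exists_ne_diag_eq_neg_one hR' hoff hi.symm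
    have h2 := Finset.add_le_sum hnn (Finset.mem_univ i) (Finset.mem_univ j) hji.symm
    rw [hsum, ← hi, hj] at h2
    rcases hstrict with h | h
    · linarith
    · refine h (hsymm fun r => ?_)
      by_cases hri : r = i
      · rw [hri, ← hi]; norm_num
      by_cases hrj : r = j
      · rw [hrj, hj]; norm_num
      have h3 := Finset.sum_le_sum_of_subset_of_nonneg (f := fun i => 1 - R i i)
        (Finset.subset_univ {i, j, r}) fun r hr _ => hnn r (Finset.mem_univ r)
      rw [hsum, Finset.sum_insert (by simp [hji.symm, Ne.symm hri]),
        Finset.sum_pair (Ne.symm hrj), ← hi, hj] at h3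
      have h4 : R r r = 1 := le_antisymm (hd r).2 (by linarith)
      rw [h4, one_pow]
  refine ⟨⟨hQ, ha, hb, fun i => ?_⟩, ?_⟩
  · rw [hang]
    exact (Real.arccos_le_pi _).lt_of_ne fun h => (hlt i).not_ge (Real.arccos_eq_pi.1 h)
  · have hpi2 : 0 < Real.pi ^ 2 := by positivity
    simp only [hang]
    have hle : ∀ i ∈ Finset.univ, Real.arccos (R i i) ^ 2 ≤ Real.pi ^ 2 / 2 * (1 - R i i) :=
      fun i _ => (arccos_sq_le (hd i).1 (hd i).2).1
    have htot : ∑ i, Real.pi ^ 2 / 2 * (1 - R i i) = Real.pi ^ 2 / 2 * (p - R.trace) := by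
      rw [← Finset.mul_sum, hsum]
    rcases hstrict with h | h
    · have := (Finset.sum_le_sum hle).trans_eq htot
      nlinarith
    · obtain ⟨i, hi⟩ : ∃ i, R i i ^ 2 ≠ 1 := by
        by_contra! hall
        exact h (hsymm hall)
      have hi1 : R i i < 1 := (hd i).2.lt_of_ne fun h1 => hi (by rw [h1, one_pow])
      have := (Finset.sum_lt_sum hle ⟨i, Finset.mem_univ i,
        (arccos_sq_le (hd i).1 (hd i).2).2 (hlt i) hi1⟩).trans_eq htot
      nlinarith

/-- For `p ≤ 4`, every rotation can be multiplied by an even sign change so that the previous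
criterion applies. -/
theorem exists_sign_change (hp : p ≤ 4) (hp2 : 2 ≤ p) {R : Mat p} (hR : R ∈ SO p) :
    ∃ ε : Fin p → ℝ, (∀ i, ε i * ε i = 1) ∧ ∏ i, ε i = 1 ∧
      (p : ℝ) - 4 ≤ (R * Matrix.diagonal ε).trace ∧
      ((p : ℝ) - 4 < (R * Matrix.diagonal ε).trace ∨ ¬ (R * Matrix.diagonal ε).IsSymm) := by
  have htr : ∀ ε : Fin p → ℝ, (R * Matrix.diagonal ε).trace = ∑ i, R i i * ε i := fun ε => by
    simp [Matrix.trace, Matrix.mul_diagonal]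
  by_contra! hcon
  have hle : ∀ ε : Fin p → ℝ, (∀ i, ε i * ε i = 1) → ∏ i, ε i = 1 →
      ∑ i, R i i * ε i ≤ (p : ℝ) - 4 := by
    intro ε h1 h2
    by_contra! hlt
    have := (hcon ε h1 h2 (by rw [htr]; exact hlt.le)).1
    rw [htr] at this
    linarith
  interval_cases p
  -- For `p ≤ 3`, the traces add up to zero, so that one of them is nonnegative.
  · have h1 := hle ![1, 1] (by simp [Fin.forall_fin_two]) (by simp)
    have h2 := hle ![-1, -1] (by simp [Fin.forall_fin_two]) (by simp)
    simp [Fin.sum_univ_two] at h1 h2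
    linarith
  · have h1 := hle ![1, 1, 1] (by simp [Fin.forall_fin_succ]) (by simp [Fin.prod_univ_succ])
    have h2 := hle ![1, -1, -1] (by simp [Fin.forall_fin_succ]) (by simp [Fin.prod_univ_succ])
    have h3 := hle ![-1, 1, -1] (by simp [Fin.forall_fin_succ]) (by simp [Fin.prod_univ_succ])
    have h4 := hle ![-1, -1, 1] (by simp [Fin.forall_fin_succ]) (by simp [Fin.prod_univ_succ])
    simp [Fin.sum_univ_three] at h1 h2 h3 h4
    linarith
  · -- All traces vanish, as `ε` and `-ε` give opposite ones; so all products are symmetric.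
    have key : ∀ ε : Fin 4 → ℝ, (∀ i, ε i * ε i = 1) → ∏ i, ε i = 1 →
        ∑ i, R i i * ε i = 0 ∧ ∀ i j, R i j * ε j = R j i * ε i := by
      intro ε h1 h2
      have e1 := hle ε h1 h2
      have e2 := hle (-ε) (by simpa using h1) (by
        rw [← h2]; simp [Fin.prod_univ_four])
      simp only [Pi.neg_apply, mul_neg, Finset.sum_neg_distrib] at e2
      norm_num at e1 e2
      have e0 : ∑ i, R i i * ε i = 0 := le_antisymm e1 e2
      refine ⟨e0, fun i j => ?_⟩
      have hs := (hcon ε h1 h2 (by rw [htr, e0]; norm_num)).2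
      have := hs.apply j i
      rwa [Matrix.mul_diagonal, Matrix.mul_diagonal] at this
    obtain ⟨t1, s1⟩ := key ![1, 1, 1, 1] (by simp [Fin.forall_fin_succ])
      (by simp [Fin.prod_univ_succ])
    obtain ⟨t2, s2⟩ := key ![1, 1, -1, -1] (by simp [Fin.forall_fin_succ])
      (by simp [Fin.prod_univ_succ])
    obtain ⟨t3, s3⟩ := key ![1, -1, 1, -1] (by simp [Fin.forall_fin_succ])
      (by simp [Fin.prod_univ_succ])
    obtain ⟨t4, -⟩ := key ![1, -1, -1, 1] (by simp [Fin.forall_fin_succ])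
      (by simp [Fin.prod_univ_succ])
    -- Adding the four traces isolates `R 0 0`, and a sign change that separates `i` from `0` makes
    -- `R i 0` both symmetric and antisymmetric, so the first column of `R` vanishes.
    have a1 := s1 1 0
    have a2 := s1 2 0
    have a3 := s1 3 0
    have b1 := s3 1 0
    have b2 := s2 2 0
    have b3 := s2 3 0
    simp at a1 a2 a3 b1 b2 b3
    simp [Fin.sum_univ_four] at t1 t2 t3 t4
    have z0 : R 0 0 = 0 := by linarith
    have z1 : R 1 0 = 0 := by linarith
    have z2 : R 2 0 = 0 := by linarith
    have z3 : R 3 0 = 0 := by linarith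
    have := sum_sq_col_of_mem_SO hR 0
    rw [Fin.sum_univ_four, z0, z1, z2, z3] at this
    norm_num at this

/-- Sign changes of the eigenvectors do not change the image under `F`. -/
theorem F_mul_diagonal {b : Mat p × Mat p} (hb : b ∈ M p) {ε : Fin p → ℝ}
    (hε : ∀ i, ε i * ε i = 1) : F (b.1 * Matrix.diagonal ε, b.2) = F b := by
  have h : Matrix.diagonal ε * b.2 * Matrix.diagonal ε = b.2 := by
    rw [← hb.2.1.diagonal_diag, Matrix.diagonal_mul_diagonal, Matrix.diagonal_mul_diagonal]
    congr 1
    funext i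
    rw [mul_right_comm, hε, one_mul]
  calc F (b.1 * Matrix.diagonal ε, b.2)
      = b.1 * (Matrix.diagonal ε * b.2 * Matrix.diagonal ε) * b.1ᵀ := by
        simp only [F, Matrix.transpose_mul, Matrix.diagonal_transpose, Matrix.mul_assoc]
    _ = F b := by rw [h, F]

theorem dSR_le_riemannianDist (k : ℝ) {a b b' : Mat p × Mat p} (ha : a ∈ M p) (hb' : b' ∈ M p)
    (hF : F b' = F b) : dSR k (F a) (F b) ≤ riemannianDist (M p) (metricM k) a b' := by
  refine csInf_le ⟨0, ?_⟩ ⟨a, ⟨ha, rfl⟩, b', ⟨hb', hF⟩, rfl⟩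
  rintro _ ⟨a, -, b, -, rfl⟩
  refine Real.sInf_nonneg ?_
  rintro _ ⟨c, -, -, -, rfl⟩
  exact curveLength_nonneg _ _ zero_le_one

/-- For `p ≤ 4`, no rotation angle between the points of a minimal pair equals `π`: otherwise, an
even sign change of the second point would decrease the distance. -/
theorem IsMinimalPair.isNonantipodalBasis (hp : p ≤ 4) {k : ℝ} (hk : 0 < k) {a b : Mat p × Mat p}
    (ha : a ∈ M p) (hb : b ∈ M p) (hab : IsMinimalPair k a b) {Q : Mat p}
    (hQ : IsAdapted (a.1ᵀ * b.1) Q) : IsNonantipodalBasis Q a b := by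
  refine ⟨hQ, ha, hb, fun i => (angle_le_pi _ _).lt_of_ne fun hi => ?_⟩
  obtain ⟨γ, ⟨hγ, -, -, -, hlen⟩, rfl, rfl⟩ := hab
  set a := γ 0
  set b := γ 1
  have hR := transpose_mul_mem_SO ha.1 hb.1
  have hR' := conj_mem_SO hR hQ.1
  rw [angle_column hQ.1 ha.1 hb.1, Real.arccos_eq_pi] at hi
  have hi' := le_antisymm hi (diag_mem_Icc_of_mem_SO hR' i).1
  obtain ⟨j, hji, hj⟩ := exists_ne_diag_eq_neg_one hR' hQ.2 hi'
  have hp2 : 2 ≤ p := by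
    by_contra! hlt
    exact hji (Fin.ext (by omega))
  have hlow : 2 * Real.pi ^ 2 ≤ ∑ i, angle (column Q a.1 i) (column Q b.1 i) ^ 2 := by
    have := Finset.add_le_sum (f := fun i => angle (column Q a.1 i) (column Q b.1 i) ^ 2)
      (fun r _ => sq_nonneg _) (Finset.mem_univ i) (Finset.mem_univ j) hji.symm
    rw [angle_column hQ.1 ha.1 hb.1, angle_column hQ.1 ha.1 hb.1, hi', hj,
      Real.arccos_neg_one] at this
    linarith
  obtain ⟨ε, hε, hprod, htr, hstrict⟩ := exists_sign_change hp hp2 hR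
  have hεSO : (Matrix.diagonal ε : Mat p) ∈ SO p := by
    refine mem_SO_of ?_ ?_
    · rw [Matrix.diagonal_transpose, Matrix.diagonal_mul_diagonal, ← Matrix.diagonal_one]
      exact congrArg Matrix.diagonal (funext hε)
    · rw [Matrix.det_diagonal, hprod]
  set b' : Mat p × Mat p := (b.1 * Matrix.diagonal ε, b.2) with hb'def
  have hb' : b' ∈ M p := ⟨mul_mem_SO hb.1 hεSO, hb.2⟩
  rw [Matrix.mul_assoc] at htr hstrict
  obtain ⟨Q', hQ'⟩ := exists_isAdapted (a.1ᵀ * b'.1)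
  obtain ⟨hbasis, hsum⟩ := sum_angle_sq_lt ha hb' hQ' htr hstrict
  have hup := (dSR_le_riemannianDist k ha hb' (F_mul_diagonal hb hε)).trans
    (riemannianDist_le_norm_gap hbasis hk.le)
  have hbelow := norm_gap_le_curveLength hk.le hQ.1 hγ le_rfl zero_le_one le_rfl
  rw [hlen] at hbelow
  have hsq := pow_le_pow_left₀ (norm_nonneg _) (hbelow.trans hup) 2
  rw [norm_gap_sq hk.le, norm_gap_sq hk.le] at hsq
  have hk2 : 0 < k / 2 := by positivity
  have := mul_lt_mul_of_pos_left (hsum.trans_le hlow) hk2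
  simp only [hb'def] at hsq this
  linarith

/-- Two `F`-minimal geodesics with the same endpoints agree if no rotation angle between the
endpoints equals `π`. -/
theorem IsNonantipodalBasis.eqOn {k : ℝ} (hk : 0 < k) {Q X Y : Mat p} {a b : Mat p × Mat p}
    (h : IsNonantipodalBasis Q a b) {γ₁ γ₂ : ℝ → Mat p × Mat p}
    (h₁ : IsFMinimalGeodesic k X Y γ₁) (h₂ : IsFMinimalGeodesic k X Y γ₂)
    (ha₁ : γ₁ 0 = a) (hb₁ : γ₁ 1 = b) (ha₂ : γ₂ 0 = a) (hb₂ : γ₂ 1 = b) :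
    Set.EqOn γ₁ γ₂ (Set.Icc 0 1) := by
  obtain ⟨c₁, s₁, f₁, g₁, l₁⟩ := h₁
  obtain ⟨c₂, s₂, -, -, l₂⟩ := h₂
  have hle : dSR k X Y ≤ ‖gap k Q a b‖ := by
    have := (dSR_le_riemannianDist (b := b) k h.left_mem h.right_mem rfl).trans
      (riemannianDist_le_norm_gap h hk.le)
    rwa [← ha₁, ← hb₁, f₁.2, g₁.2, ha₁, hb₁] at this
  exact eqOn_of_curveLength_le hk h.isAdapted.1 h.angle_lt_pi c₁ s₁ ha₁ hb₁ (l₁.trans_le hle)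
    c₂ s₂ ha₂ hb₂ (l₂.trans_le hle)

end ScalingRotation

theorem mainTheorem3 (p : ℕ) (hp : p ≤ 4) (k : ℝ) (hk : 0 < k) :
    (∀ a ∈ ScalingRotation.M p, ∀ b ∈ ScalingRotation.M p,
      ScalingRotation.IsMinimalPair k a b → ¬ ScalingRotation.GeodesicallyAntipodal a b) ∧
    (∀ X ∈ ScalingRotation.SymPos p, ∀ Y ∈ ScalingRotation.SymPos p,
      1 < (ScalingRotation.MSSR k X Y).encard →
        ScalingRotation.TypeINonuniqueness k X Y ∧
          ¬ ScalingRotation.TypeIINonuniqueness k X Y) := by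
  open ScalingRotation in
  refine ⟨fun a ha b hb hab => ?_, fun X _ Y _ hcard => ?_⟩
  · obtain ⟨Q, hQ⟩ := exists_isAdapted (a.1ᵀ * b.1)
    have h := (hab.isNonantipodalBasis hp hk ha hb hQ).prodMk_one
    rintro (hcut | hcut)
    · exact h.notMem_cutLocus hcut
    · exact h.symm.notMem_cutLocus hcut
  · have hII : ¬ TypeIINonuniqueness k X Y := by
      rintro ⟨γ₁, γ₂, h₁, h₂, ⟨t, ht, hne⟩, heq⟩
      obtain ⟨e0, e1⟩ := Prod.mk.inj heq
      obtain ⟨ha, hX⟩ := h₁.2.2.1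
      obtain ⟨hb, hY⟩ := h₁.2.2.2.1
      obtain ⟨Q, hQ⟩ := exists_isAdapted ((γ₁ 0).1ᵀ * (γ₁ 1).1)
      have hpair : IsMinimalPair k (γ₁ 0) (γ₁ 1) := ⟨γ₁, by rwa [hX, hY], rfl, rfl⟩
      have h := hpair.isNonantipodalBasis hp hk ha hb hQ
      exact hne (congrArg F (h.eqOn hk h₁ h₂ rfl rfl e0.symm e1.symm ht))
    refine ⟨?_, hII⟩
    obtain ⟨χ₁, χ₂, ⟨γ₁, h₁, hχ₁⟩, ⟨γ₂, h₂, hχ₂⟩, hne⟩ := Set.one_lt_encard_iff.1 hcard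
    obtain ⟨t, ht⟩ := Function.ne_iff.1 hne
    rw [hχ₁, hχ₂] at ht
    exact ⟨γ₁, γ₂, h₁, h₂, ⟨t, t.2, ht⟩, fun heq => hII ⟨γ₁, γ₂, h₁, h₂, ⟨t, t.2, ht⟩, heq⟩⟩
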